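/- Let $d\ge 3$. On the discrete torus $\Lambda_n=(\mathbb Z/n\mathbb Z)^d$, let $-\Delta f(x)=2d\,f(x)-\sum_{y\sim x}f(y)$ be the negative discrete Laplacian, with eigenvalues $(\eta_w)_w$, where $\eta_0=0$ is simple, and a corresponding orthogonal matrix $Q$ of eigenvectors. The zero-average Green's function on $\Lambda_n$ is the matrix $$G^{0\text{-avg.}}_{\Lambda_n}=Q\,\mathrm{diag}\big(0,(1/\eta_w)_{w\ne0}\big)\,Q^T .$$ Let $G_{\mathbb Z^d}(x,y)=\frac1{2d}\sum_{k\ge0}\mathbb P^x[X_k=y]$, where $X$ is simple random walk on $\mathbb Z^d$; this series converges since $d\ge3$. Points of $\mathbb Z^d$ are viewed as points of $\Lambda_n$ through the canonical projection. Then: 1. There exist $C=C(d)>0$ and $N=N(d)$ such that for all $n\ge N$ and all $y\in[-n/2,n/2)^d\cap\mathbb Z^d$, $$\big|G^{0\text{-avg.}}_{\Lambda_n}(0,y)-G_{\mathbb Z^d}(0,y)\big|\le C\,n^{2-d}.$$ In particular, for every $a>0$ there exist $C'=C'(d,a)>0$ and $N'=N'(d,a)$ such that $|G^{0\text{-avg.}}_{\Lambda_n}(0,y)|\le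 C'n^{2-d}$ for all $n\ge N'$ and all $y\in[-n/2,n/2)^d\cap\mathbb Z^d$ with Euclidean norm $|y|\ge a n$. 2. If $d=3$, there exist absolute constants $c,C>0$ and $N$ such that for all $n\ge N$ and all $x\in\mathbb Z^3$, $$-\frac{C}{n}\le G^{0\text{-avg.}}_{\Lambda_n}(x,x)-G_{\mathbb Z^3}(x,x)\le-\frac{c}{n}<0 .$$ -/

import Mathlib

/-- The negative discrete Laplacian `-Δ f (x) = 2d f(x) - ∑_{y ∼ x} f(y)` for the nearest-neighbour
structure on `R^d`; with `R = ZMod n` this is the discrete torus `(ℤ/nℤ)^d`. The neighbours of `x`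
are `x ± e_i` (for `n ≤ 2`, where these are not `2d` distinct points, they are counted with
multiplicity). -/
def negLaplacian (d : ℕ) (R : Type) [Ring R] :
    ((Fin d → R) → ℝ) →ₗ[ℝ] ((Fin d → R) → ℝ) where
  toFun f x := 2 * (d : ℝ) * f x - ∑ i : Fin d, (f (x + Pi.single i 1) + f (x - Pi.single i 1))
  map_add' f g := by
    funext x
    simp only [Pi.add_apply, Finset.sum_add_distrib]
    ring
  map_smul' c f := by
    funext x
    simp only [Pi.smul_apply, smul_eq_mul, RingHom.id_apply, Finset.sum_add_distrib,
      ← Finset.mul_sum]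
    ring

/-- The matrix of `-Δ` on the discrete torus `(ℤ/nℤ)^d`. -/
noncomputable def torusLaplacianMatrix (d n : ℕ) [NeZero n] :
    Matrix (Fin d → ZMod n) (Fin d → ZMod n) ℝ :=
  LinearMap.toMatrix' (negLaplacian d (ZMod n))

theorem torusLaplacianMatrix_isHermitian (d n : ℕ) [NeZero n] :
    (torusLaplacianMatrix d n).IsHermitian := by
  ext x y
  simp only [torusLaplacianMatrix, Matrix.conjTranspose_apply, star_trivial,
    LinearMap.toMatrix'_apply, negLaplacian, LinearMap.coe_mk, AddHom.coe_mk, Pi.single_apply]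
  congr 1
  · simp only [eq_comm]
  · refine Finset.sum_congr rfl fun i _ => ?_
    rw [add_comm]
    congr 1
    · exact if_congr ⟨fun h => by rw [← h]; abel, fun h => by rw [← h]; abel⟩ rfl rfl
    · exact if_congr ⟨fun h => by rw [← h]; abel, fun h => by rw [← h]; abel⟩ rfl rfl

/-- The zero-average Green's function `Q diag(0, (1/η_w)_{w ≠ 0}) Qᵀ` on the discrete torus
`(ℤ/nℤ)^d`, where `η_w` are the eigenvalues of `-Δ` and the columns of the orthogonal matrix `Q`
are corresponding eigenvectors. The eigenvalue `0` is simple (constant functions). -/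
noncomputable def zeroAvgGreen (d n : ℕ) [NeZero n] :
    Matrix (Fin d → ZMod n) (Fin d → ZMod n) ℝ :=
  let hL := torusLaplacianMatrix_isHermitian d n
  let Q : Matrix (Fin d → ZMod n) (Fin d → ZMod n) ℝ := hL.eigenvectorUnitary
  Q * Matrix.diagonal (fun w => if hL.eigenvalues w = 0 then 0 else 1 / hL.eigenvalues w) *
    Q.transpose

/-- The `k`-step transition probability `P^x[X_k = y]` of simple random walk on `ℤ^d`. -/
noncomputable def srwProb (d : ℕ) : ℕ → (Fin d → ℤ) → (Fin d → ℤ) → ℝ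
  | 0, x, y => if x = y then 1 else 0
  | k + 1, x, y => 1 / (2 * (d : ℝ)) *
      ∑ i : Fin d, (srwProb d k (x + Pi.single i 1) y + srwProb d k (x - Pi.single i 1) y)

/-- The Green's function `G(x, y) = (1 / 2d) ∑_{k ≥ 0} P^x[X_k = y]` of `ℤ^d` (for `d ≥ 3`). -/
noncomputable def latticeGreen (d : ℕ) (x y : Fin d → ℤ) : ℝ :=
  1 / (2 * (d : ℝ)) * ∑' k : ℕ, srwProb d k x y

/-- The canonical projection `ℤ^d → (ℤ/nℤ)^d`. -/
def torusProj (d n : ℕ) (x : Fin d → ℤ) : Fin d → ZMod n := fun i => (x i : ZMod n)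

/-- The fundamental box `[-n/2, n/2)^d ∩ ℤ^d`. -/
def fundamentalBox (d n : ℕ) : Set (Fin d → ℤ) :=
  {y | ∀ i, -((n : ℝ) / 2) ≤ (y i : ℝ) ∧ (y i : ℝ) < (n : ℝ) / 2}

/-- The Euclidean norm of a point of `ℤ^d`. -/
noncomputable def latticeNorm {d : ℕ} (y : Fin d → ℤ) : ℝ :=
  Real.sqrt (∑ i, (y i : ℝ) ^ 2)

/-!
Both Green's functions are time integrals of heat kernels of the continuous-time walk whose
coordinates are independent walks of jump rate `2`. On `ℤ` such a walk is a difference `A - B` of two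
Poisson variables of mean `t`, and on the cycle it is `A - B` modulo `n`. So the kernel on `ℤ` is a sum
of nonnegative terms, contained termwise in the kernel on the cycle, which in turn is an explicit
finite Fourier sum.

*Heat kernel bounds.* Fourier inversion on the cycle, with the character moved to the circle of
radius `exp l`, gives a Chernoff bound that keeps the on-diagonal decay (`tsum_tilted_le`). Comparing
the Fourier sum with a Gaussian integral gives `torusReturn_le`; letting the cycle grow gives the
bound `0.45 / √t` on `ℤ`. The difference of the two kernels is the mass that winds around the cycle,
hence Gaussian small (`cyclicHeatKernel_zmod_sub_int_le_chernoff`), while after a time of order `n²`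
the kernel on the cycle is exponentially close to `1 / n` (`torusOscillation_le`).

*Identification.* The torus kernel solves the heat equation, so its centred time integral inverts the
Laplacian on functions of zero average and is therefore the spectral pseudo-inverse
(`zeroAvgGreen_eq`). Splitting the time integrals at `0.08 n²` shows that it is within `C n ^ (2 - d)`
of the time integral `heatGreen` on `ℤ ^ d` (`exists_abs_torusGreen_sub_heatGreen_le`). Letting `n`
tend to infinity in the Poisson equation on the torus yields the one on `ℤ ^ d`, and iterating the
latter along the walk identifies `heatGreen` with the Green's function of simple random walk: the
remainder is dominated by the decay of `heatGreen` at infinity and by transition probabilities, which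
are summable (`latticeGreen_eq`).

*The sign in dimension three.* At the origin, centring contributes `-0.08 / n` up to time `0.08 n²`.
The winding mass up to that time contributes at most `0.0495 / n`, the nonconstant modes after it at
most `0.014 / n`, and the heat kernel of `ℤ³` after it has a favourable sign
(`torusGreen_sub_heatGreen_le`).
-/

/-! ### Differences of Poisson variables -/

/-- The joint law of `(A, B)` with `A`, `B` independent Poisson variables of mean `t`; the position
`A - B` is that of a continuous-time simple random walk on `ℤ` with jump rate `2`. -/
noncomputable def poissonPairWeight (t : ℝ) (p : ℕ × ℕ) : ℝ :=
  Real.exp (-(2 * t)) * (t ^ p.1 / (p.1.factorial : ℝ) * (t ^ p.2 / (p.2.factorial : ℝ)))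

theorem poissonPairWeight_nonneg {t : ℝ} (ht : 0 ≤ t) (p : ℕ × ℕ) : 0 ≤ poissonPairWeight t p := by
  unfold poissonPairWeight; positivity

theorem hasSum_mul_of_summable_norm {f g : ℕ → ℂ} {a b : ℂ} (hf : HasSum f a) (hg : HasSum g b)
    (hf' : Summable fun k => ‖f k‖) (hg' : Summable fun k => ‖g k‖) :
    HasSum (fun p : ℕ × ℕ => f p.1 * g p.2) (a * b) :=
  hf.mul hg (summable_mul_of_summable_norm hf' hg')

theorem hasSum_poissonPairWeight_mul_pow (t : ℝ) {z : ℂ} (hz : z ≠ 0) :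
    HasSum (fun p : ℕ × ℕ => (poissonPairWeight t p : ℂ) * z ^ ((p.1 : ℤ) - (p.2 : ℤ)))
      (Complex.exp (t * (z + z⁻¹ - 2))) := by
  have key (u : ℂ) : HasSum (fun k : ℕ => u ^ k / (k.factorial : ℂ)) (Complex.exp u) := by
    rw [Complex.exp_eq_exp_ℂ]; exact NormedSpace.expSeries_div_hasSum_exp u
  have hn (u : ℂ) : Summable fun k : ℕ => ‖u ^ k / (k.factorial : ℂ)‖ :=
    NormedSpace.norm_expSeries_div_summable u
  have h0 := hasSum_mul_of_summable_norm (key (t * z)) (key (t * z⁻¹)) (hn (t * z)) (hn (t * z⁻¹))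
  have h := h0.mul_left (Complex.exp (-(2 * t)))
  have e : Complex.exp (-(2 * t)) * (Complex.exp (t * z) * Complex.exp (t * z⁻¹)) =
      Complex.exp (t * (z + z⁻¹ - 2)) := by
    rw [← Complex.exp_add, ← Complex.exp_add]; congr 1; ring
  rw [e] at h
  refine h.congr_fun fun p => ?_
  rw [zpow_sub₀ hz, zpow_natCast, zpow_natCast, mul_pow, mul_pow, inv_pow, poissonPairWeight]
  push_cast
  ring

theorem hasSum_poissonPairWeight_exp (t l : ℝ) :
    HasSum (fun p : ℕ × ℕ => poissonPairWeight t p * Real.exp (l * ((p.1 : ℝ) - p.2)))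
      (Real.exp (2 * t * (Real.cosh l - 1))) := by
  have h := hasSum_poissonPairWeight_mul_pow t (z := (Real.exp l : ℂ)) (by
    exact_mod_cast (Real.exp_pos l).ne')
  rw [← Complex.hasSum_ofReal]
  convert h using 1
  · funext p
    push_cast
    rw [← Complex.exp_int_mul]
    push_cast
    ring_nf
  · rw [Real.cosh_eq]
    push_cast
    rw [Complex.exp_neg]
    congr 1
    ring

theorem hasSum_poissonPairWeight (t : ℝ) : HasSum (poissonPairWeight t) 1 := by
  simpa using hasSum_poissonPairWeight_exp t 0

theorem summable_poissonPairWeight_ite (t : ℝ) (P : ℕ × ℕ → Prop) [DecidablePred P] :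
    Summable fun p => poissonPairWeight t p * (if P p then (1 : ℝ) else 0) :=
  Summable.of_norm_bounded (hasSum_poissonPairWeight t).summable.abs fun p => by
    rw [norm_mul, Real.norm_eq_abs]
    split_ifs <;> simp

/-- The heat kernel `P[A - B = x]` of the rate `2` walk on the cyclic group `R` generated by `1`,
used with `R = ℤ` and `R = ZMod n`. -/
noncomputable def cyclicHeatKernel (R : Type) [Ring R] [DecidableEq R] (t : ℝ) (x : R) : ℝ :=
  ∑' p : ℕ × ℕ, poissonPairWeight t p * (if ((p.1 : R) - p.2) = x then 1 else 0)

section kernel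
variable (R : Type) [Ring R] [DecidableEq R]

theorem cyclicHeatKernel_nonneg {t : ℝ} (ht : 0 ≤ t) (x : R) : 0 ≤ cyclicHeatKernel R t x :=
  tsum_nonneg fun p => mul_nonneg (poissonPairWeight_nonneg ht p) (by split_ifs <;> simp)

theorem cyclicHeatKernel_le_one {t : ℝ} (ht : 0 ≤ t) (x : R) : cyclicHeatKernel R t x ≤ 1 := by
  rw [← (hasSum_poissonPairWeight t).tsum_eq]
  refine Summable.tsum_le_tsum (fun p => ?_) (summable_poissonPairWeight_ite t _)
    (hasSum_poissonPairWeight t).summable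
  have := poissonPairWeight_nonneg ht p
  split_ifs <;> simp [this]

end kernel

theorem cyclicHeatKernel_int_neg (t : ℝ) (x : ℤ) :
    cyclicHeatKernel ℤ t (-x) = cyclicHeatKernel ℤ t x := by
  rw [cyclicHeatKernel, ← (Equiv.prodComm ℕ ℕ).tsum_eq]
  refine tsum_congr fun p => ?_
  simp only [Equiv.prodComm_apply, Prod.swap, poissonPairWeight]
  rw [mul_comm (t ^ p.2 / _)]
  congr 2
  exact propext ⟨fun h => by linarith, fun h => by linarith⟩

theorem cyclicHeatKernel_int_le_zmod {n : ℕ} {t : ℝ} (ht : 0 ≤ t) (x : ℤ) :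
    cyclicHeatKernel ℤ t x ≤ cyclicHeatKernel (ZMod n) t (x : ZMod n) := by
  refine Summable.tsum_le_tsum (fun p => ?_) (summable_poissonPairWeight_ite t _)
    (summable_poissonPairWeight_ite t _)
  refine mul_le_mul_of_nonneg_left ?_ (poissonPairWeight_nonneg ht p)
  by_cases h : (p.1 : ℤ) - p.2 = x
  · have : (p.1 : ZMod n) - p.2 = x := by rw [← h]; push_cast; ring
    simp [h, this]
  · rw [if_neg h]; split_ifs <;> simp

/-! ### Fourier inversion on the cycle -/

/-- `cos (2 π j / n)`, the real part of the standard character of `ZMod n`. -/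
noncomputable def torusCos {n : ℕ} [NeZero n] (j : ZMod n) : ℝ := (ZMod.stdAddChar j).re

section torus
variable {n : ℕ} [NeZero n]

theorem torusCos_intCast (j : ℤ) : torusCos (j : ZMod n) = Real.cos (2 * Real.pi * j / n) := by
  rw [torusCos, ZMod.stdAddChar_coe]
  have : 2 * (Real.pi : ℂ) * Complex.I * j / n = ((2 * Real.pi * j / n : ℝ) : ℂ) * Complex.I := by
    push_cast; ring
  rw [this, Complex.exp_ofReal_mul_I_re]

theorem norm_stdAddChar (j : ZMod n) : ‖ZMod.stdAddChar j‖ = 1 := by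
  rw [ZMod.stdAddChar_apply]; exact Circle.norm_coe _

theorem abs_torusCos_le_one (j : ZMod n) : |torusCos j| ≤ 1 :=
  (Complex.abs_re_le_norm _).trans (norm_stdAddChar j).le

theorem torusCos_le_one (j : ZMod n) : torusCos j ≤ 1 :=
  (le_abs_self _).trans (abs_torusCos_le_one j)

theorem torusCos_zero : torusCos (0 : ZMod n) = 1 := by
  simp [torusCos]

theorem torusCos_neg (j : ZMod n) : torusCos (-j) = torusCos j := by
  simp only [torusCos, AddChar.map_neg_eq_conj, Complex.conj_re]

theorem torusCos_add_add_torusCos_sub (a b : ZMod n) :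
    torusCos (a + b) + torusCos (a - b) = 2 * torusCos a * torusCos b := by
  simp only [torusCos, sub_eq_add_neg, AddChar.map_add_eq_mul, AddChar.map_neg_eq_conj,
    Complex.mul_re, Complex.conj_re, Complex.conj_im]
  ring

theorem sum_torusCos_mul (b : ZMod n) :
    ∑ j : ZMod n, torusCos (j * b) = if b = 0 then (n : ℝ) else 0 := by
  have h := congrArg Complex.re (AddChar.sum_mulShift b (ZMod.isPrimitive_stdAddChar n))
  rw [Complex.re_sum] at h
  simp only [torusCos]
  rw [h, ZMod.card]
  split_ifs <;> simp

/-- The return probability `P[A - B ≡ 0 mod n]`, written by Fourier inversion on `ZMod n`; it is the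
maximum of the heat kernel of the cycle. -/
noncomputable def torusReturn (n : ℕ) [NeZero n] (t : ℝ) : ℝ :=
  (n : ℝ)⁻¹ * ∑ j : ZMod n, Real.exp (-(2 * t * (1 - torusCos j)))

/-- Fourier inversion on `ZMod n` for the exponentially tilted law of `A - B mod n`: the factor
`exp (l * (A - B))` moves the character to the circle of radius `exp l`. -/
theorem hasSum_tilted (t l : ℝ) (x : ZMod n) :
    HasSum (fun p : ℕ × ℕ => ((poissonPairWeight t p *
        (Real.exp (l * ((p.1 : ℝ) - p.2)) * if ((p.1 : ZMod n) - p.2) = x then 1 else 0) : ℝ) : ℂ))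
      ((n : ℂ)⁻¹ * ∑ j : ZMod n, ZMod.stdAddChar (-(j * x)) *
        Complex.exp (t * (Real.exp l * ZMod.stdAddChar j + (Real.exp l * ZMod.stdAddChar j)⁻¹ - 2))) := by
  have hz (j : ZMod n) : (Real.exp l : ℂ) * ZMod.stdAddChar j ≠ 0 := by
    rw [← norm_ne_zero_iff, norm_mul, norm_stdAddChar]
    simp
  have h := (hasSum_sum (s := Finset.univ) fun (j : ZMod n) _ =>
    (hasSum_poissonPairWeight_mul_pow t (hz j)).mul_left (ZMod.stdAddChar (-(j * x)))).mul_left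
      ((n : ℂ)⁻¹)
  refine h.congr_fun fun p => Eq.symm ?_
  have e1 (j : ZMod n) : ZMod.stdAddChar (-(j * x)) * ((poissonPairWeight t p : ℂ) *
      ((Real.exp l : ℂ) * ZMod.stdAddChar j) ^ ((p.1 : ℤ) - (p.2 : ℤ))) =
      (poissonPairWeight t p : ℂ) * (Real.exp l : ℂ) ^ ((p.1 : ℤ) - (p.2 : ℤ)) *
        ZMod.stdAddChar (j * ((p.1 : ZMod n) - (p.2 : ZMod n) - x)) := by
    rw [mul_zpow, ← AddChar.map_zsmul_eq_zpow]
    have : j * ((p.1 : ZMod n) - p.2 - x) = -(j * x) + ((p.1 : ℤ) - (p.2 : ℤ)) • j := by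
      rw [zsmul_eq_mul]; push_cast; ring
    rw [this, AddChar.map_add_eq_mul]
    ring
  simp only [e1]
  rw [← Finset.mul_sum, AddChar.sum_mulShift _ (ZMod.isPrimitive_stdAddChar n), ZMod.card]
  have e2 : (Real.exp l : ℂ) ^ ((p.1 : ℤ) - (p.2 : ℤ)) = (Real.exp (l * ((p.1 : ℝ) - p.2)) : ℂ) := by
    push_cast
    rw [← Complex.exp_int_mul]
    push_cast
    ring_nf
  rw [e2]
  have hn : (n : ℂ) ≠ 0 := by exact_mod_cast NeZero.ne n
  by_cases hx : (p.1 : ZMod n) - p.2 = x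
  · simp only [hx, sub_self, if_true]
    push_cast
    field_simp
  · have : (p.1 : ZMod n) - p.2 - x ≠ 0 := sub_ne_zero.mpr hx
    simp [hx, this]

theorem stdAddChar_inv (j : ZMod n) :
    (ZMod.stdAddChar j)⁻¹ = (starRingEnd ℂ) (ZMod.stdAddChar j : ℂ) := by
  rw [← AddChar.map_neg_eq_conj, AddChar.map_neg_eq_inv]

theorem cyclicHeatKernel_zmod {t : ℝ} (x : ZMod n) :
    cyclicHeatKernel (ZMod n) t x =
      (n : ℝ)⁻¹ * ∑ j : ZMod n, torusCos (j * x) * Real.exp (-(2 * t * (1 - torusCos j))) := by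
  have h := Complex.hasSum_re (hasSum_tilted t 0 x)
  simp only [Complex.ofReal_re, zero_mul, Real.exp_zero, one_mul] at h
  rw [cyclicHeatKernel, h.tsum_eq]
  have (j : ZMod n) : Complex.exp (t * ((1 : ℝ) * ZMod.stdAddChar j +
      ((1 : ℝ) * ZMod.stdAddChar j)⁻¹ - 2)) = (Real.exp (-(2 * t * (1 - torusCos j))) : ℝ) := by
    rw [Complex.ofReal_one, one_mul, stdAddChar_inv, Complex.add_conj]
    push_cast [torusCos]
    ring_nf
  simp only [this]
  rw [← Complex.ofReal_natCast, ← Complex.ofReal_inv, Complex.re_ofReal_mul, Complex.re_sum]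
  simp only [Complex.re_mul_ofReal]
  congr 1
  refine Finset.sum_congr rfl fun j _ => ?_
  congr 1
  exact torusCos_neg _

theorem cyclicHeatKernel_zmod_zero (t : ℝ) : cyclicHeatKernel (ZMod n) t 0 = torusReturn n t := by
  rw [cyclicHeatKernel_zmod, torusReturn]
  simp [torusCos_zero]

theorem cyclicHeatKernel_zmod_le (t : ℝ) (x : ZMod n) :
    cyclicHeatKernel (ZMod n) t x ≤ torusReturn n t := by
  rw [cyclicHeatKernel_zmod, torusReturn]
  gcongr with j
  exact mul_le_of_le_one_left (Real.exp_pos _).le (torusCos_le_one _)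

theorem torusReturn_le_one {t : ℝ} (ht : 0 ≤ t) : torusReturn n t ≤ 1 :=
  cyclicHeatKernel_zmod_zero (n := n) t ▸ cyclicHeatKernel_le_one _ ht _

theorem torusReturn_nonneg (t : ℝ) : 0 ≤ torusReturn n t := by
  unfold torusReturn; positivity

/-- The Chernoff-type bound: tilting costs `exp (2 t (cosh l - 1))` but keeps the decay of the
return probability, since `cosh l ≥ 1`. -/
theorem tsum_tilted_le {t : ℝ} (ht : 0 ≤ t) (l : ℝ) (x : ZMod n) :
    ∑' p : ℕ × ℕ, poissonPairWeight t p *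
        (Real.exp (l * ((p.1 : ℝ) - p.2)) * if ((p.1 : ZMod n) - p.2) = x then 1 else 0) ≤
      Real.exp (2 * t * (Real.cosh l - 1)) * torusReturn n t := by
  have h := Complex.hasSum_re (hasSum_tilted t l x)
  simp only [Complex.ofReal_re] at h
  rw [h.tsum_eq]
  refine (Complex.re_le_norm _).trans ?_
  rw [norm_mul, norm_inv, Complex.norm_natCast, torusReturn, mul_left_comm]
  refine mul_le_mul_of_nonneg_left ?_ (by positivity)
  rw [Finset.mul_sum]
  refine (norm_sum_le _ _).trans (Finset.sum_le_sum fun j _ => ?_)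
  rw [norm_mul, norm_stdAddChar, one_mul, Complex.norm_exp, ← Real.exp_add]
  apply Real.exp_le_exp.mpr
  have e : ((t : ℂ) * (Real.exp l * ZMod.stdAddChar j + (Real.exp l * ZMod.stdAddChar j)⁻¹ - 2)).re
      = t * (2 * Real.cosh l * torusCos j - 2) := by
    rw [mul_inv, stdAddChar_inv, ← Complex.ofReal_inv, Complex.re_ofReal_mul, Complex.sub_re,
      Complex.add_re, Complex.re_ofReal_mul, Complex.re_ofReal_mul, Complex.conj_re, torusCos,
      Real.cosh_eq, Real.exp_neg]
    simp only [Complex.re_ofNat]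
    ring
  rw [e]
  have h1 := Real.one_le_cosh l
  have h2 := torusCos_le_one j
  nlinarith [mul_nonneg ht (mul_nonneg (sub_nonneg.mpr h1) (sub_nonneg.mpr h2))]

theorem summable_tilted {t : ℝ} (ht : 0 ≤ t) (l : ℝ) (P : ℕ × ℕ → Prop) [DecidablePred P] :
    Summable fun p : ℕ × ℕ => poissonPairWeight t p *
        (Real.exp (l * ((p.1 : ℝ) - p.2)) * if P p then 1 else 0) :=
  Summable.of_nonneg_of_le
    (fun p => mul_nonneg (poissonPairWeight_nonneg ht p) (by split_ifs <;> positivity))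
    (fun p => mul_le_mul_of_nonneg_left (by split_ifs <;> simp; positivity)
      (poissonPairWeight_nonneg ht p))
    (hasSum_poissonPairWeight_exp t l).summable

theorem cyclicHeatKernel_int_le_tilted {t : ℝ} (ht : 0 ≤ t) (l : ℝ) (x : ℤ) :
    Real.exp (l * x) * cyclicHeatKernel ℤ t x ≤
      Real.exp (2 * t * (Real.cosh l - 1)) * torusReturn n t := by
  refine le_trans ?_ (tsum_tilted_le ht l (x : ZMod n))
  rw [cyclicHeatKernel, ← tsum_mul_left]
  refine Summable.tsum_le_tsum (fun p => ?_) ((summable_poissonPairWeight_ite t _).mul_left _)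
    (summable_tilted ht l _)
  rw [mul_left_comm]
  refine mul_le_mul_of_nonneg_left ?_ (poissonPairWeight_nonneg ht p)
  by_cases h : (p.1 : ℤ) - p.2 = x
  · have : (p.1 : ZMod n) - p.2 = x := by rw [← h]; push_cast; ring
    rw [if_pos h, if_pos this, ← h]
    push_cast
    rfl
  · rw [if_neg h]; split_ifs <;> simp; positivity

/-- The wrap-around mass `P[A - B ≡ x mod n, A - B ≠ x]` is carried by points at distance at least
`ρ` from the origin. -/
theorem cyclicHeatKernel_zmod_sub_int_le {t : ℝ} (ht : 0 ≤ t) {l ρ : ℝ} (hl : 0 ≤ l) (x : ℤ)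
    (hx : ∀ m : ℤ, (m : ZMod n) = x → m ≠ x → ρ ≤ |(m : ℝ)|) :
    cyclicHeatKernel (ZMod n) t (x : ZMod n) - cyclicHeatKernel ℤ t x ≤
      2 * Real.exp (-(l * ρ) + 2 * t * (Real.cosh l - 1)) * torusReturn n t := by
  have h1 := tsum_tilted_le ht l (x : ZMod n)
  have h2 := tsum_tilted_le ht (-l) (x : ZMod n)
  rw [Real.cosh_neg] at h2
  have h3 := mul_le_mul_of_nonneg_left (add_le_add h1 h2) (Real.exp_pos (-(l * ρ))).le
  rw [Real.exp_add]
  refine le_trans ?_ (h3.trans_eq (by ring))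
  rw [cyclicHeatKernel, cyclicHeatKernel, ← Summable.tsum_sub (summable_poissonPairWeight_ite t _)
    (summable_poissonPairWeight_ite t _), ← Summable.tsum_add (summable_tilted ht l _)
    (summable_tilted ht (-l) _), ← tsum_mul_left]
  refine Summable.tsum_le_tsum (fun p => ?_) ((summable_poissonPairWeight_ite t _).sub
    (summable_poissonPairWeight_ite t _)) (((summable_tilted ht l _).add
      (summable_tilted ht (-l) _)).mul_left _)
  rw [← mul_sub, ← mul_add, mul_left_comm]
  refine mul_le_mul_of_nonneg_left ?_ (poissonPairWeight_nonneg ht p)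
  by_cases hp : (p.1 : ZMod n) - p.2 = x
  · simp only [hp, if_true]
    by_cases h : (p.1 : ℤ) - p.2 = x
    · simp only [h, if_true, sub_self]; positivity
    · have := hx ((p.1 : ℤ) - p.2) (by push_cast; exact hp) h
      push_cast at this
      simp only [h, if_false, sub_zero, mul_one]
      rw [mul_add, ← Real.exp_add, ← Real.exp_add]
      rcases le_abs.mp this with h4 | h4
      · have : 1 ≤ Real.exp (-(l * ρ) + l * ((p.1 : ℝ) - p.2)) := Real.one_le_exp (by nlinarith)
        linarith [Real.exp_pos (-(l * ρ) + -l * ((p.1 : ℝ) - p.2))]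
      · have : 1 ≤ Real.exp (-(l * ρ) + -l * ((p.1 : ℝ) - p.2)) := Real.one_le_exp (by nlinarith)
        linarith [Real.exp_pos (-(l * ρ) + l * ((p.1 : ℝ) - p.2))]
  · have h : (p.1 : ℤ) - p.2 ≠ x := fun h => hp (by rw [← h]; push_cast; ring)
    simp [hp, h]

end torus

/-! ### Chernoff factors and bounds in one dimension -/

/-- The Chernoff rate: with the tilt `l = min (1/4) (ρ / 2t)` the mass at distance at least `ρ` at
time `t` gains the factor `exp (-0.24 min (ρ / 2) (ρ² / t))`. -/
noncomputable def chernoffFactor (ρ t : ℝ) : ℝ := Real.exp (-(0.24 * min (ρ / 2) (ρ ^ 2 / t)))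

theorem chernoffFactor_nonneg (ρ t : ℝ) : 0 ≤ chernoffFactor ρ t := (Real.exp_pos _).le

theorem exp_neg_three_le : Real.exp (-3) ≤ 0.05 := by
  have h := Real.exp_one_gt_d9
  have e : Real.exp 3 = Real.exp 1 ^ 3 := by rw [← Real.exp_nat_mul]; norm_num
  rw [Real.exp_neg, show (0.05 : ℝ) = 20⁻¹ by norm_num, e]
  refine inv_anti₀ (by norm_num) ?_
  calc (20 : ℝ) ≤ 2.718 ^ 3 := by norm_num
    _ ≤ _ := pow_le_pow_left₀ (by norm_num) (by linarith) 3

theorem cosh_sub_one_le {l : ℝ} (h0 : 0 ≤ l) (h : l ≤ 1 / 4) : Real.cosh l - 1 ≤ 0.52 * l ^ 2 := by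
  have h1 := Real.cosh_le_exp_half_sq l
  have hl : l ^ 2 ≤ 1 / 16 := by nlinarith
  have h2 := Real.exp_bound_div_one_sub_of_interval (x := l ^ 2 / 2) (by positivity) (by linarith)
  have h3 : 1 / (1 - l ^ 2 / 2) ≤ 1 + 0.52 * l ^ 2 := by
    rw [div_le_iff₀ (by linarith)]
    nlinarith [sq_nonneg l, mul_nonneg (sq_nonneg l) (sub_nonneg.mpr hl)]
  linarith

/-- The exponent `-l ρ + 2t (cosh l - 1)` is nearly optimal at `l = ρ / 2t`; for times below `2ρ` this
would leave the range where `cosh l - 1` is close to `l² / 2`, and `l = 1/4` is used instead. -/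
theorem exists_tilt {ρ t : ℝ} (hρ : 0 < ρ) (ht : 0 < t) : ∃ l : ℝ, 0 ≤ l ∧
    Real.exp (-(l * ρ) + 2 * t * (Real.cosh l - 1)) ≤ chernoffFactor ρ t := by
  rcases le_total t (2 * ρ) with h | h
  · refine ⟨1 / 4, by norm_num, Real.exp_le_exp.mpr ?_⟩
    have h1 := cosh_sub_one_le (l := 1 / 4) (by norm_num) le_rfl
    have h2 : min (ρ / 2) (ρ ^ 2 / t) ≤ ρ / 2 := min_le_left _ _
    nlinarith [mul_le_mul_of_nonneg_left h1 ht.le]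
  · refine ⟨ρ / (2 * t), by positivity, Real.exp_le_exp.mpr ?_⟩
    have h1 := cosh_sub_one_le (l := ρ / (2 * t)) (by positivity)
      (by rw [div_le_iff₀ (by positivity)]; linarith)
    have h2 : min (ρ / 2) (ρ ^ 2 / t) ≤ ρ ^ 2 / t := min_le_right _ _
    have h3 := mul_le_mul_of_nonneg_left h1 (by positivity : 0 ≤ 2 * t)
    have h4 : 2 * t * (0.52 * (ρ / (2 * t)) ^ 2) = 0.26 * (ρ ^ 2 / t) := by field_simp; norm_num
    have h5 : ρ / (2 * t) * ρ = 0.5 * (ρ ^ 2 / t) := by field_simp; norm_num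
    linarith

/-- Gaussian decay beats the on-diagonal factor `t ^ (-d / 2)` uniformly in time. -/
theorem exists_chernoffFactor_mul_pow_le (d : ℕ) {K : ℝ} (hK : 0 ≤ K) : ∃ C : ℝ, 0 < C ∧
    ∀ ρ t κ : ℝ, 0 < ρ → 0 < t → 0 ≤ κ → κ ≤ 1 → κ ≤ K / √t →
      chernoffFactor ρ t * κ ^ d ≤ C / ρ ^ d := by
  refine ⟨d.factorial / 0.12 ^ d + d.factorial * Real.exp 1 * (K / √0.24) ^ d,
    by positivity, fun ρ t κ hρ ht h0 h1 h2 => ?_⟩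
  rw [add_div]
  rcases le_total t (2 * ρ) with h | h
  · have e1 : ρ / 2 ≤ ρ ^ 2 / t := by
      rw [div_le_div_iff₀ (by norm_num) ht]; nlinarith
    have e2 := Real.pow_div_factorial_le_exp (0.12 * ρ) (by positivity) d
    have e3 : chernoffFactor ρ t ≤ d.factorial / 0.12 ^ d / ρ ^ d := by
      rw [chernoffFactor, min_eq_left e1, Real.exp_neg, div_div, ← mul_pow,
        show 0.24 * (ρ / 2) = 0.12 * ρ by ring, inv_le_comm₀ (Real.exp_pos _) (by positivity),
        inv_div]
      exact e2
    calc _ ≤ chernoffFactor ρ t * 1 :=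
          mul_le_mul_of_nonneg_left (pow_le_one₀ h0 h1) (chernoffFactor_nonneg _ _)
      _ ≤ _ := by rw [mul_one]; exact e3.trans (le_add_of_nonneg_right (by positivity))
  · have e1 : ρ ^ 2 / t ≤ ρ / 2 := by
      rw [div_le_div_iff₀ ht (by norm_num)]; nlinarith
    set u := 0.24 * (ρ ^ 2 / t) with hu
    have hu0 : 0 ≤ u := by positivity
    have e2 : K / √t = K / √0.24 * (√u / ρ) := by
      rw [hu, Real.sqrt_mul (by norm_num), Real.sqrt_div (by positivity), Real.sqrt_sq hρ.le]
      have : √0.24 ≠ 0 := by positivity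
      have : √t ≠ 0 := by positivity
      field_simp
    have e3 : √u ≤ 1 + u := by
      rw [Real.sqrt_le_left (by positivity)]; nlinarith
    have e4 : √u ^ d * Real.exp (-u) ≤ d.factorial * Real.exp 1 := by
      have := Real.pow_div_factorial_le_exp (1 + u) (by positivity) d
      rw [div_le_iff₀ (by positivity), Real.exp_add] at this
      rw [Real.exp_neg, ← div_eq_mul_inv, div_le_iff₀ (Real.exp_pos _)]
      calc √u ^ d ≤ (1 + u) ^ d := pow_le_pow_left₀ (by positivity) e3 d
        _ ≤ _ := this
        _ = _ := by ring
    calc _ ≤ Real.exp (-u) * (K / √0.24 * (√u / ρ)) ^ d := by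
          rw [chernoffFactor, min_eq_right e1, ← e2]
          gcongr
      _ = (√u ^ d * Real.exp (-u)) * (K / √0.24) ^ d / ρ ^ d := by
          rw [mul_pow, div_pow (√u)]; ring
      _ ≤ d.factorial * Real.exp 1 * (K / √0.24) ^ d / ρ ^ d := by gcongr
      _ ≤ _ := le_add_of_nonneg_left (by positivity)

section torus
variable {n : ℕ} [NeZero n]

theorem sum_valMinAbs_le {F : ℤ → ℝ} (hF : ∀ k, 0 ≤ F k) :
    ∑ j ∈ Finset.univ.erase (0 : ZMod n), F j.valMinAbs ≤
      ∑ i ∈ Finset.range n, (F (i + 1) + F (-(i + 1))) := by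
  rw [Finset.sum_add_distrib]
  have e1 : ∑ i ∈ Finset.range n, F (i + 1) =
      ∑ k ∈ (Finset.range n).image (fun i : ℕ => (i : ℤ) + 1), F k := by
    rw [Finset.sum_image]; intro a _ b _ h; simpa using h
  have e2 : ∑ i ∈ Finset.range n, F (-(i + 1)) =
      ∑ k ∈ (Finset.range n).image (fun i : ℕ => -((i : ℤ) + 1)), F k := by
    rw [Finset.sum_image]; intro a _ b _ h; simpa using h
  rw [e1, e2, ← Finset.sum_union, ← Finset.sum_image (f := F)
    (fun a _ b _ h => ZMod.injective_valMinAbs h)]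
  · refine Finset.sum_le_sum_of_subset_of_nonneg (fun k hk => ?_) fun k _ _ => hF k
    simp only [Finset.mem_image, Finset.mem_erase, Finset.mem_univ, and_true] at hk
    obtain ⟨j, hj, rfl⟩ := hk
    have h0 : j.valMinAbs ≠ 0 := by rwa [Ne, ZMod.valMinAbs_eq_zero]
    obtain ⟨h1, h2⟩ := ZMod.valMinAbs_mem_Ioc j
    simp only [Finset.mem_union, Finset.mem_image, Finset.mem_range]
    rcases lt_or_gt_of_ne h0 with h | h
    · exact Or.inr ⟨(-j.valMinAbs - 1).toNat, by omega, by omega⟩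
    · exact Or.inl ⟨(j.valMinAbs - 1).toNat, by omega, by omega⟩
  · rw [Finset.disjoint_left]
    intro k h1 h2
    simp only [Finset.mem_image] at h1 h2
    obtain ⟨a, -, rfl⟩ := h1
    obtain ⟨b, -, h⟩ := h2
    omega

theorem torusCos_eq (j : ZMod n) : torusCos j = Real.cos (2 * Real.pi * j.valMinAbs / n) := by
  rw [← torusCos_intCast, ZMod.coe_valMinAbs]

theorem one_sub_torusCos_ge_quadratic (j : ZMod n) :
    8 * (j.valMinAbs : ℝ) ^ 2 / n ^ 2 ≤ 1 - torusCos j := by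
  have hn : (0 : ℝ) < n := by exact_mod_cast NeZero.pos n
  obtain ⟨h1, h2⟩ := ZMod.valMinAbs_mem_Ioc j
  have h1' : -(n : ℝ) < j.valMinAbs * 2 := by exact_mod_cast h1
  have h2' : (j.valMinAbs : ℝ) * 2 ≤ n := by exact_mod_cast h2
  have h3 : |2 * Real.pi * j.valMinAbs / n| ≤ Real.pi := by
    rw [abs_le]
    constructor
    · rw [le_div_iff₀ hn]; nlinarith [Real.pi_pos]
    · rw [div_le_iff₀ hn]; nlinarith [Real.pi_pos]
  have h4 := Real.cos_le_one_sub_mul_cos_sq h3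
  have e : 2 / Real.pi ^ 2 * (2 * Real.pi * j.valMinAbs / n) ^ 2 =
      8 * (j.valMinAbs : ℝ) ^ 2 / n ^ 2 := by
    field_simp; ring
  rw [torusCos_eq]
  linarith

/-- A bound linear in the frequency, so that the Fourier sum is geometric. The lowest frequency has
to be treated almost sharply: its eigenvalue is close to `4π² / n²`, and `38 < 4π²` leaves room for
the fourth-order term. -/
theorem one_sub_torusCos_ge_linear (hn : 11 ≤ n) {j : ZMod n} (hj : j ≠ 0) :
    38 + 26 * (|(j.valMinAbs : ℝ)| - 1) ≤ 2 * n ^ 2 * (1 - torusCos j) := by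
  have hn0 : (11 : ℝ) ≤ n := by exact_mod_cast hn
  have h0 : j.valMinAbs ≠ 0 := by rwa [Ne, ZMod.valMinAbs_eq_zero]
  by_cases h : |j.valMinAbs| = 1
  · have h' : |(j.valMinAbs : ℝ)| = 1 := by exact_mod_cast h
    have e : torusCos j = Real.cos (2 * Real.pi / n) := by
      rw [torusCos_eq, ← Real.cos_abs, abs_div, abs_mul, h', mul_one, abs_of_pos, Nat.abs_cast]
      positivity
    have hp := Real.pi_lt_d2
    have hp' := Real.pi_gt_d2
    have hx : 2 * Real.pi / n ≤ 0.6 := by rw [div_le_iff₀ (by linarith)]; linarith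
    have hx0 : 0 ≤ 2 * Real.pi / n := by positivity
    have hb := Real.cos_bound (x := 2 * Real.pi / n) (by rw [abs_of_nonneg hx0]; linarith)
    rw [abs_of_nonneg hx0, ← e] at hb
    have hb' := (abs_le.mp hb).2
    have e3 : (n : ℝ) * (2 * Real.pi / n) = 2 * Real.pi := by field_simp
    set x := 2 * Real.pi / n
    rw [h']
    have : x ^ 2 / 2 - x ^ 4 * (5 / 96) ≤ 1 - torusCos j := by linarith
    have e4 : 2 * (n : ℝ) ^ 2 * (x ^ 2 / 2 - x ^ 4 * (5 / 96)) =
      4 * Real.pi ^ 2 * (1 - x ^ 2 * (5 / 48)) := by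
      calc _ = ((n : ℝ) * x) ^ 2 * (1 - x ^ 2 * (5 / 48)) := by ring
        _ = _ := by rw [e3]; ring
    have hx2 : x ^ 2 ≤ 0.36 := by nlinarith
    have := mul_le_mul_of_nonneg_left this (by positivity : 0 ≤ 2 * (n : ℝ) ^ 2)
    have hpp : 3.14 ^ 2 ≤ Real.pi ^ 2 := by nlinarith
    rw [e4] at this
    nlinarith
  · have h2 : 2 ≤ |j.valMinAbs| := by
      have := abs_pos.mpr h0; omega
    have h2' : 2 ≤ |(j.valMinAbs : ℝ)| := by exact_mod_cast h2
    have h3 := one_sub_torusCos_ge_quadratic j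
    rw [div_le_iff₀ (by positivity), ← sq_abs] at h3
    nlinarith

/-- The contribution of the nonzero frequencies to `n * torusReturn n t`. -/
noncomputable def torusOscillation (n : ℕ) [NeZero n] (t : ℝ) : ℝ :=
  ∑ j ∈ Finset.univ.erase (0 : ZMod n), Real.exp (-(2 * t * (1 - torusCos j)))

theorem torusOscillation_nonneg (t : ℝ) : 0 ≤ torusOscillation n t := by
  unfold torusOscillation; positivity

theorem torusReturn_eq (t : ℝ) : torusReturn n t = (n : ℝ)⁻¹ * (1 + torusOscillation n t) := by
  rw [torusReturn, torusOscillation, ← Finset.add_sum_erase _ _ (Finset.mem_univ (0 : ZMod n))]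
  simp [torusCos_zero]

theorem abs_cyclicHeatKernel_zmod_sub_le (t : ℝ) (x : ZMod n) :
    |cyclicHeatKernel (ZMod n) t x - (n : ℝ)⁻¹| ≤ (n : ℝ)⁻¹ * torusOscillation n t := by
  have : cyclicHeatKernel (ZMod n) t x - (n : ℝ)⁻¹ = (n : ℝ)⁻¹ *
      ∑ j ∈ Finset.univ.erase (0 : ZMod n),
        torusCos (j * x) * Real.exp (-(2 * t * (1 - torusCos j))) := by
    rw [cyclicHeatKernel_zmod, ← Finset.add_sum_erase _ _ (Finset.mem_univ (0 : ZMod n))]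
    simp [torusCos_zero]
    ring
  rw [this, abs_mul, abs_of_nonneg (by positivity : 0 ≤ (n : ℝ)⁻¹)]
  refine mul_le_mul_of_nonneg_left ?_ (by positivity)
  refine (Finset.abs_sum_le_sum_abs _ _).trans (Finset.sum_le_sum fun j _ => ?_)
  rw [abs_mul, Real.abs_exp]
  exact mul_le_of_le_one_left (Real.exp_pos _).le (abs_torusCos_le_one _)

theorem torusOscillation_le (hn : 11 ≤ n) {t : ℝ} (ht : 0.08 * (n : ℝ) ^ 2 ≤ t) :
    torusOscillation n t ≤ 3 * Real.exp (-(38 / (n : ℝ) ^ 2 * t)) := by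
  have hn0 : (0 : ℝ) < n := by exact_mod_cast (by omega : 0 < n)
  set s := t / (n : ℝ) ^ 2 with hs
  have hs0 : 0.08 ≤ s := by rw [hs, le_div_iff₀ (by positivity)]; exact ht
  have hts : t = s * n ^ 2 := by rw [hs]; field_simp
  set r := Real.exp (-(26 * s)) with hr
  have hr1 : r ≤ 1 / 3 := by
    rw [hr, Real.exp_neg, one_div]
    have := Real.add_one_le_exp (26 * s)
    exact inv_anti₀ (by norm_num) (by linarith)
  have hr0 : 0 ≤ r := (Real.exp_pos _).le
  have e : 38 / (n : ℝ) ^ 2 * t = 38 * s := by rw [hs]; ring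
  rw [e]
  calc torusOscillation n t
      ≤ ∑ j ∈ Finset.univ.erase (0 : ZMod n),
          (fun k : ℤ => Real.exp (-((38 + 26 * (|(k : ℝ)| - 1)) * s))) j.valMinAbs := by
        refine Finset.sum_le_sum fun j hj => Real.exp_le_exp.mpr ?_
        have := one_sub_torusCos_ge_linear hn (Finset.ne_of_mem_erase hj)
        rw [hts]
        nlinarith
    _ ≤ ∑ i ∈ Finset.range n, (Real.exp (-((38 + 26 * (|((i + 1 : ℤ) : ℝ)| - 1)) * s)) +
          Real.exp (-((38 + 26 * (|((-(i + 1) : ℤ) : ℝ)| - 1)) * s))) :=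
        sum_valMinAbs_le (F := fun k : ℤ => Real.exp (-((38 + 26 * (|(k : ℝ)| - 1)) * s)))
          fun k => (Real.exp_pos _).le
    _ = ∑ i ∈ Finset.range n, 2 * Real.exp (-(38 * s)) * r ^ i := by
        refine Finset.sum_congr rfl fun i _ => ?_
        push_cast
        rw [abs_neg, abs_of_nonneg (by positivity : (0 : ℝ) ≤ i + 1), ← two_mul, mul_assoc, hr,
          ← Real.exp_nat_mul, ← Real.exp_add]
        congr 2
        ring
    _ ≤ 2 * Real.exp (-(38 * s)) * (1 - r)⁻¹ := by
        rw [← Finset.mul_sum]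
        refine mul_le_mul_of_nonneg_left ?_ (by positivity)
        exact (summable_geometric_of_lt_one hr0 (by linarith)).sum_le_tsum _
          (fun i _ => by positivity) |>.trans_eq (tsum_geometric_of_lt_one hr0 (by linarith))
    _ ≤ 2 * Real.exp (-(38 * s)) * (3 / 2) := by
        refine mul_le_mul_of_nonneg_left ?_ (by positivity)
        rw [inv_le_comm₀ (by linarith) (by norm_num)]
        linarith
    _ = _ := by ring

/-- Comparison of the Fourier sum with a Gaussian integral; the constant is `√π / 4 ≤ 0.45`. -/
theorem torusReturn_le {t : ℝ} (ht : 0 < t) :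
    torusReturn n t ≤ (n : ℝ)⁻¹ + 0.45 / √t := by
  have hn0 : (0 : ℝ) < n := by exact_mod_cast NeZero.pos n
  rw [torusReturn_eq, mul_add, mul_one, add_le_add_iff_left]
  set b := 16 * t / (n : ℝ) ^ 2 with hb
  have hb0 : 0 < b := by positivity
  have hanti : AntitoneOn (fun u : ℝ => Real.exp (-b * u ^ 2)) (Set.Ici 0) := by
    intro u hu v hv huv
    simp only [Set.mem_Ici] at hu
    refine Real.exp_le_exp.mpr ?_
    nlinarith [mul_le_mul_of_nonneg_left (pow_le_pow_left₀ hu huv 2) hb0.le]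
  have key : torusOscillation n t ≤ √(Real.pi / b) := by
    calc torusOscillation n t
        ≤ ∑ j ∈ Finset.univ.erase (0 : ZMod n),
            (fun k : ℤ => Real.exp (-b * (k : ℝ) ^ 2)) j.valMinAbs := by
          refine Finset.sum_le_sum fun j hj => Real.exp_le_exp.mpr ?_
          have := mul_le_mul_of_nonneg_left (one_sub_torusCos_ge_quadratic j)
            (by positivity : 0 ≤ 2 * t)
          have e : 2 * t * (8 * (j.valMinAbs : ℝ) ^ 2 / n ^ 2) = b * j.valMinAbs ^ 2 := by
            rw [hb]; ring
          linarith
      _ ≤ ∑ i ∈ Finset.range n, (Real.exp (-b * ((i + 1 : ℤ) : ℝ) ^ 2) +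
            Real.exp (-b * ((-(i + 1) : ℤ) : ℝ) ^ 2)) :=
          sum_valMinAbs_le (F := fun k : ℤ => Real.exp (-b * (k : ℝ) ^ 2))
            fun k => (Real.exp_pos _).le
      _ = 2 * ∑ i ∈ Finset.range n, Real.exp (-b * (0 + ((i + 1 : ℕ) : ℝ)) ^ 2) := by
          rw [Finset.mul_sum]
          refine Finset.sum_congr rfl fun i _ => ?_
          push_cast
          rw [two_mul, neg_sq, zero_add]
      _ ≤ 2 * ∫ u in (0 : ℝ)..0 + n, Real.exp (-b * u ^ 2) := by
          refine mul_le_mul_of_nonneg_left ?_ (by norm_num)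
          exact AntitoneOn.sum_le_integral (hanti.mono Set.Icc_subset_Ici_self)
      _ ≤ 2 * ∫ u in Set.Ioi (0 : ℝ), Real.exp (-b * u ^ 2) := by
          refine mul_le_mul_of_nonneg_left ?_ (by norm_num)
          rw [intervalIntegral.integral_of_le (by linarith)]
          exact MeasureTheory.setIntegral_mono_set (integrable_exp_neg_mul_sq hb0).integrableOn
            (Filter.Eventually.of_forall fun u => (Real.exp_pos _).le)
            Set.Ioc_subset_Ioi_self.eventuallyLE
      _ = √(Real.pi / b) := by rw [integral_gaussian_Ioi]; ring
  have e : √(Real.pi / b) = n * (√Real.pi / 4 / √t) := by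
    have : Real.pi / b = (n / 4) ^ 2 * (Real.pi / t) := by rw [hb]; field_simp; norm_num
    rw [this, Real.sqrt_mul (by positivity), Real.sqrt_sq (by positivity),
      Real.sqrt_div Real.pi_pos.le]
    ring
  have e2 : √Real.pi ≤ 1.8 := by
    rw [Real.sqrt_le_left (by norm_num)]; linarith [Real.pi_lt_d2]
  rw [e] at key
  calc _ ≤ (n : ℝ)⁻¹ * (n * (√Real.pi / 4 / √t)) := by gcongr
    _ = √Real.pi / 4 / √t := by field_simp
    _ ≤ _ := by gcongr; linarith

end torus

/-- The kernel on `ℤ` is dominated by that on every cycle, in particular on arbitrarily long ones. -/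
theorem cyclicHeatKernel_int_le {t : ℝ} (ht : 0 < t) (x : ℤ) :
    cyclicHeatKernel ℤ t x ≤ 0.45 / √t := by
  have h : Filter.Tendsto (fun m : ℕ => ((m + 1 : ℕ) : ℝ)⁻¹ + 0.45 / √t) Filter.atTop
      (nhds (0 + 0.45 / √t)) :=
    ((tendsto_inv_atTop_nhds_zero_nat (𝕜 := ℝ)).comp (Filter.tendsto_add_atTop_nat 1)).add_const _
  rw [zero_add] at h
  exact ge_of_tendsto' h fun m => (cyclicHeatKernel_int_le_zmod (n := m + 1) ht.le x).trans
    ((cyclicHeatKernel_zmod_le t _).trans (torusReturn_le ht))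

theorem cyclicHeatKernel_int_le_chernoff {t ρ : ℝ} (ht : 0 < t) (hρ : 0 < ρ) (x : ℤ)
    (hx : ρ ≤ |(x : ℝ)|) :
    cyclicHeatKernel ℤ t x ≤ chernoffFactor ρ t * min 1 (0.45 / √t) := by
  wlog h0 : 0 ≤ x generalizing x
  · rw [← cyclicHeatKernel_int_neg]
    exact this (-x) (by push_cast; rwa [abs_neg]) (by omega)
  have h0' : (0 : ℝ) ≤ x := by exact_mod_cast h0
  rw [abs_of_nonneg h0'] at hx
  obtain ⟨l, hl, h⟩ := exists_tilt hρ ht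
  have key (D : ℝ) (hD : ∃ m : ℕ, torusReturn (m + 1) t ≤ D) :
      cyclicHeatKernel ℤ t x ≤ chernoffFactor ρ t * D := by
    obtain ⟨m, hm⟩ := hD
    have h1 := cyclicHeatKernel_int_le_tilted (n := m + 1) ht.le l x
    have h2 := mul_le_mul_of_nonneg_left h1 (Real.exp_pos (-(l * ρ))).le
    rw [← mul_assoc, ← mul_assoc, ← Real.exp_add, ← Real.exp_add] at h2
    have h3 : 1 ≤ Real.exp (-(l * ρ) + l * x) := Real.one_le_exp (by nlinarith)
    have h4 := cyclicHeatKernel_nonneg ℤ ht.le x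
    calc _ ≤ Real.exp (-(l * ρ) + l * x) * cyclicHeatKernel ℤ t x := le_mul_of_one_le_left h4 h3
      _ ≤ _ := h2
      _ ≤ _ := mul_le_mul h hm (torusReturn_nonneg t) (chernoffFactor_nonneg _ _)
  rcases le_total 1 (0.45 / √t) with h5 | h5
  · rw [min_eq_left h5]; exact key 1 ⟨0, torusReturn_le_one ht.le⟩
  · rw [min_eq_right h5]
    have h : Filter.Tendsto (fun m : ℕ => chernoffFactor ρ t * (((m + 1 : ℕ) : ℝ)⁻¹ + 0.45 / √t))
        Filter.atTop (nhds (chernoffFactor ρ t * (0 + 0.45 / √t))) :=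
      (((tendsto_inv_atTop_nhds_zero_nat (𝕜 := ℝ)).comp
        (Filter.tendsto_add_atTop_nat 1)).add_const _).const_mul _
    rw [zero_add] at h
    exact ge_of_tendsto' h fun m => key _ ⟨m, torusReturn_le ht⟩

section torus
variable {n : ℕ} [NeZero n]

theorem cyclicHeatKernel_zmod_sub_int_le_chernoff {t ρ : ℝ} (ht : 0 < t) (hρ : 0 < ρ) (x : ℤ)
    (hx : ∀ m : ℤ, (m : ZMod n) = x → m ≠ x → ρ ≤ |(m : ℝ)|) :
    cyclicHeatKernel (ZMod n) t (x : ZMod n) - cyclicHeatKernel ℤ t x ≤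
      2 * chernoffFactor ρ t * torusReturn n t := by
  obtain ⟨l, hl, h⟩ := exists_tilt hρ ht
  refine (cyclicHeatKernel_zmod_sub_int_le ht.le hl x hx).trans ?_
  have := torusReturn_nonneg (n := n) t
  gcongr

theorem le_abs_of_intCast_eq_zero {n : ℕ} (m : ℤ) (h : (m : ZMod n) = ((0 : ℤ) : ZMod n))
    (h0 : m ≠ 0) :
    (n : ℝ) ≤ |(m : ℝ)| := by
  rw [Int.cast_zero, ZMod.intCast_zmod_eq_zero_iff_dvd] at h
  have := Int.le_of_dvd (abs_pos.mpr h0) ((dvd_abs _ _).mpr h)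
  exact_mod_cast this

theorem half_le_abs_of_intCast_eq {n : ℕ} {x m : ℤ} (h : (m : ZMod n) = x) (h0 : m ≠ x)
    (h1 : -((n : ℝ) / 2) ≤ x) (h2 : (x : ℝ) < n / 2) : (n : ℝ) / 2 ≤ |(m : ℝ)| := by
  have h3 : (n : ℝ) ≤ |((m - x : ℤ) : ℝ)| :=
    le_abs_of_intCast_eq_zero (m - x) (by push_cast; rw [h, sub_self]) (sub_ne_zero.mpr h0)
  have h4 : |(x : ℝ)| ≤ n / 2 := abs_le.mpr ⟨h1, h2.le⟩
  have h5 := abs_sub (m : ℝ) x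
  push_cast at h3
  linarith

/-- Up to time `0.08 n²` at most a tenth of the return probability comes from winding around the
torus, so that it inherits the bound on the line. -/
theorem torusReturn_le_of_le (hn : 25 ≤ n) {t : ℝ} (ht : 0 < t) (htn : t ≤ 0.08 * (n : ℝ) ^ 2) :
    torusReturn n t ≤ 0.5 / √t := by
  have hn0 : (25 : ℝ) ≤ n := by exact_mod_cast hn
  have h := cyclicHeatKernel_zmod_sub_int_le_chernoff (n := n) (ρ := n) ht (by linarith) 0
    le_abs_of_intCast_eq_zero
  rw [Int.cast_zero, cyclicHeatKernel_zmod_zero] at h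
  have h1 := cyclicHeatKernel_int_le ht 0
  have h2 : chernoffFactor n t ≤ 0.05 := by
    have h3 : 12.5 ≤ min ((n : ℝ) / 2) ((n : ℝ) ^ 2 / t) := by
      refine le_min (by linarith) ?_
      rw [le_div_iff₀ ht]; linarith
    exact (Real.exp_le_exp.mpr (by linarith)).trans exp_neg_three_le
  have h5 : 2 * chernoffFactor n t * torusReturn n t ≤ 2 * 0.05 * torusReturn n t := by
    have := torusReturn_nonneg (n := n) t
    gcongr
  have e : (0.45 : ℝ) / √t = 0.9 * (0.5 / √t) := by ring
  linarith

end torus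

/-! ### The Green's function of the torus -/

/-- Group inverses are unique: `G` and `M` commute with `A` and are generalized inverses of it. -/
theorem eq_of_groupInverse {S : Type*} [Semiring S] {A G M : S} (h1 : A * G = G * A)
    (h2 : A * G * A = A) (h3 : G * A * G = G) (k1 : A * M = M * A) (k2 : A * M * A = A)
    (k3 : M * A * M = M) : G = M := by
  have e1 : G * A = G * A * (M * A) := by
    calc G * A = G * (A * M * A) := by rw [k2]
      _ = _ := by simp only [mul_assoc]
  have e2 : M * A = G * A * (M * A) := by
    calc M * A = A * G * A * M := by rw [h2, k1]
      _ = A * G * (A * M) := by simp only [mul_assoc]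
      _ = _ := by rw [h1, k1]
  have e : G * A = M * A := by rw [e1, ← e2]
  calc G = M * A * G := by rw [← e, h3]
    _ = M * (A * G) := mul_assoc _ _ _
    _ = M * A * M := by rw [h1, e, mul_assoc, k1]
    _ = M := k3

/-- The heat kernel of the continuous-time walk on `R ^ d`: the coordinates are independent. -/
noncomputable def productHeatKernel (R : Type) [Ring R] [DecidableEq R] {d : ℕ} (t : ℝ)
    (x : Fin d → R) : ℝ :=
  ∏ i, cyclicHeatKernel R t (x i)

theorem productHeatKernel_nonneg (R : Type) [Ring R] [DecidableEq R] {d : ℕ} {t : ℝ} (ht : 0 ≤ t)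
    (x : Fin d → R) : 0 ≤ productHeatKernel R t x :=
  Finset.prod_nonneg fun _ _ => cyclicHeatKernel_nonneg R ht _

theorem abs_prod_one_add_sub_one_le {ι : Type*} (s : Finset ι) (u : ι → ℝ) {ε : ℝ}
    (h : ∀ i ∈ s, |u i| ≤ ε) : |∏ i ∈ s, (1 + u i) - 1| ≤ (1 + ε) ^ s.card - 1 := by
  classical
  induction s using Finset.induction_on with
  | empty => simp
  | insert a s ha ih =>
    have h1 := ih fun i hi => h i (Finset.mem_insert_of_mem hi)
    have h2 := h a (Finset.mem_insert_self a s)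
    rw [Finset.prod_insert ha, Finset.card_insert_of_notMem ha]
    have e : (1 + u a) * ∏ i ∈ s, (1 + u i) - 1 =
        (1 + u a) * (∏ i ∈ s, (1 + u i) - 1) + u a := by ring
    have h3 : |1 + u a| ≤ 1 + ε := (abs_add_le _ _).trans (by rw [abs_one]; linarith)
    rw [e]
    calc _ ≤ |1 + u a| * |∏ i ∈ s, (1 + u i) - 1| + |u a| := by
          rw [← abs_mul]; exact abs_add_le _ _
      _ ≤ (1 + ε) * ((1 + ε) ^ s.card - 1) + ε := by
          have := (abs_nonneg _).trans h3
          gcongr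
      _ = _ := by ring

theorem one_add_pow_sub_one_le {ε : ℝ} (h0 : 0 ≤ ε) (h1 : ε ≤ 1) (d : ℕ) :
    (1 + ε) ^ d - 1 ≤ (2 ^ d - 1) * ε := by
  induction d with
  | zero => simp
  | succ d ih =>
    have : (1 : ℝ) ≤ 2 ^ d := one_le_pow₀ (by norm_num)
    rw [pow_succ, pow_succ]
    nlinarith [mul_nonneg (mul_nonneg (sub_nonneg.mpr this) h0) (sub_nonneg.mpr h1)]

section torus
variable {n : ℕ} [NeZero n]

theorem cyclicHeatKernel_zmod_zero_time (x : ZMod n) :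
    cyclicHeatKernel (ZMod n) 0 x = if x = 0 then 1 else 0 := by
  rw [cyclicHeatKernel_zmod]
  have hn : (n : ℝ) ≠ 0 := by exact_mod_cast NeZero.ne n
  simp [sum_torusCos_mul, hn]

/-- The heat equation on the cycle. -/
theorem hasDerivAt_cyclicHeatKernel_zmod (x : ZMod n) (t : ℝ) :
    HasDerivAt (fun t => cyclicHeatKernel (ZMod n) t x)
      (cyclicHeatKernel (ZMod n) t (x + 1) + cyclicHeatKernel (ZMod n) t (x - 1) -
        2 * cyclicHeatKernel (ZMod n) t x) t := by
  have e : (fun t => cyclicHeatKernel (ZMod n) t x) = fun t => (n : ℝ)⁻¹ * ∑ j : ZMod n,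
      torusCos (j * x) * Real.exp (-(2 * t * (1 - torusCos j))) := by
    funext t; exact cyclicHeatKernel_zmod x
  rw [e]
  have h : HasDerivAt (fun t => (n : ℝ)⁻¹ * ∑ j : ZMod n,
      torusCos (j * x) * Real.exp (-(2 * t * (1 - torusCos j)))) ((n : ℝ)⁻¹ * ∑ j : ZMod n,
      torusCos (j * x) * (Real.exp (-(2 * t * (1 - torusCos j))) * (-(2 * 1 * (1 - torusCos j)))))
      t := by
    refine HasDerivAt.const_mul _ (HasDerivAt.fun_sum fun j _ => HasDerivAt.const_mul _ ?_)
    exact ((((hasDerivAt_id t).const_mul 2).mul_const _).neg).exp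
  convert h using 1
  simp only [cyclicHeatKernel_zmod]
  rw [← mul_add, mul_left_comm, ← mul_sub, ← Finset.sum_add_distrib, Finset.mul_sum,
    ← Finset.sum_sub_distrib]
  congr 1
  refine Finset.sum_congr rfl fun j _ => ?_
  have := torusCos_add_add_torusCos_sub (j * x) j
  rw [show j * (x + 1) = j * x + j by ring, show j * (x - 1) = j * x - j by ring, ← add_mul, this]
  ring

theorem continuous_cyclicHeatKernel_zmod (x : ZMod n) :
    Continuous fun t => cyclicHeatKernel (ZMod n) t x :=
  continuous_iff_continuousAt.mpr fun t => (hasDerivAt_cyclicHeatKernel_zmod x t).continuousAt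

theorem sum_cyclicHeatKernel_zmod (t : ℝ) :
    ∑ x : ZMod n, cyclicHeatKernel (ZMod n) t x = 1 := by
  have hn : (n : ℝ) ≠ 0 := by exact_mod_cast NeZero.ne n
  simp only [cyclicHeatKernel_zmod]
  rw [← Finset.mul_sum, Finset.sum_comm]
  simp only [← Finset.sum_mul]
  have (j : ZMod n) : ∑ x, torusCos (j * x) = if j = 0 then (n : ℝ) else 0 := by
    simp_rw [mul_comm j]; exact sum_torusCos_mul j
  simp [this, torusCos_zero, hn]

theorem cyclicHeatKernel_zmod_neg (t : ℝ) (x : ZMod n) :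
    cyclicHeatKernel (ZMod n) t (-x) = cyclicHeatKernel (ZMod n) t x := by
  simp only [cyclicHeatKernel_zmod, mul_neg, torusCos_neg]

variable {d : ℕ}

theorem continuous_productHeatKernel_zmod (x : Fin d → ZMod n) :
    Continuous fun t => productHeatKernel (ZMod n) t x :=
  continuous_finsetProd _ fun _ _ => continuous_cyclicHeatKernel_zmod _

theorem hasDerivAt_productHeatKernel_zmod (x : Fin d → ZMod n) (t : ℝ) :
    HasDerivAt (fun t => productHeatKernel (ZMod n) t x)
      (-(negLaplacian d (ZMod n) (productHeatKernel (ZMod n) t) x)) t := by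
  have h := HasDerivAt.fun_finsetProd (u := Finset.univ) (x := t) fun (i : Fin d) _ =>
    hasDerivAt_cyclicHeatKernel_zmod (x i) t
  refine h.congr_deriv (Eq.symm ?_)
  simp only [negLaplacian, LinearMap.coe_mk, AddHom.coe_mk, smul_eq_mul]
  have key (i : Fin d) (y : Fin d → ZMod n) (hy : ∀ j, j ≠ i → y j = x j) :
      productHeatKernel (ZMod n) t y =
        (∏ j ∈ Finset.univ.erase i, cyclicHeatKernel (ZMod n) t (x j)) *
        cyclicHeatKernel (ZMod n) t (y i) := by
    rw [productHeatKernel, ← Finset.prod_erase_mul _ _ (Finset.mem_univ i)]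
    congr 1
    exact Finset.prod_congr rfl fun j hj => by rw [hy j (Finset.ne_of_mem_erase hj)]
  have e1 : 2 * (d : ℝ) * productHeatKernel (ZMod n) t x =
      ∑ i : Fin d, 2 * productHeatKernel (ZMod n) t x := by
    rw [Finset.sum_const, Finset.card_univ, Fintype.card_fin, nsmul_eq_mul]; ring
  rw [e1, ← Finset.sum_sub_distrib, ← Finset.sum_neg_distrib]
  refine Finset.sum_congr rfl fun i _ => ?_
  rw [key i x (fun _ _ => rfl), key i (x + Pi.single i 1) (fun j hj => by simp [hj]),
    key i (x - Pi.single i 1) (fun j hj => by simp [hj])]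
  simp only [Pi.add_apply, Pi.sub_apply, Pi.single_eq_same]
  ring

theorem productHeatKernel_zmod_zero_time (x : Fin d → ZMod n) :
    productHeatKernel (ZMod n) 0 x = if x = 0 then 1 else 0 := by
  simp only [productHeatKernel, cyclicHeatKernel_zmod_zero_time]
  rw [Finset.prod_ite_zero]
  simp only [Finset.mem_univ, true_implies, Finset.prod_const_one]
  exact if_congr funext_iff.symm rfl rfl

theorem sum_productHeatKernel_zmod (t : ℝ) :
    ∑ x : Fin d → ZMod n, productHeatKernel (ZMod n) t x = 1 := by
  have := Finset.prod_univ_sum (fun _ : Fin d => (Finset.univ : Finset (ZMod n)))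
    (fun _ x => cyclicHeatKernel (ZMod n) t x)
  simp only [sum_cyclicHeatKernel_zmod, Finset.prod_const_one, Fintype.piFinset_univ] at this
  exact this.symm

theorem abs_productHeatKernel_zmod_sub_le (t : ℝ) (x : Fin d → ZMod n) :
    |productHeatKernel (ZMod n) t x - ((n : ℝ) ^ d)⁻¹| ≤
      ((n : ℝ) ^ d)⁻¹ * ((1 + torusOscillation n t) ^ d - 1) := by
  have hn : (0 : ℝ) < n := by exact_mod_cast NeZero.pos n
  have e : productHeatKernel (ZMod n) t x - ((n : ℝ) ^ d)⁻¹ = ((n : ℝ) ^ d)⁻¹ *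
      (∏ i, (1 + (n * cyclicHeatKernel (ZMod n) t (x i) - 1)) - 1) := by
    simp only [add_sub_cancel, Finset.prod_mul_distrib, Finset.prod_const, Finset.card_univ,
      Fintype.card_fin, productHeatKernel]
    field_simp
  rw [e, abs_mul, abs_of_pos (by positivity)]
  refine mul_le_mul_of_nonneg_left ?_ (by positivity)
  have h := abs_prod_one_add_sub_one_le Finset.univ
    (fun i => n * cyclicHeatKernel (ZMod n) t (x i) - 1) (ε := torusOscillation n t) fun i _ => ?_
  · simpa using h
  · have h1 := mul_le_mul_of_nonneg_left (abs_cyclicHeatKernel_zmod_sub_le t (x i)) hn.le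
    rw [← abs_of_pos hn, ← abs_mul, abs_of_pos hn, mul_sub, ← mul_assoc, mul_inv_cancel₀ hn.ne',
      one_mul] at h1
    exact h1

theorem torusOscillation_le_const (hn : 11 ≤ n) {t : ℝ} (ht : 0.08 * (n : ℝ) ^ 2 ≤ t) :
    torusOscillation n t ≤ 0.15 := by
  have hn0 : (0 : ℝ) < n := by exact_mod_cast (by omega : 0 < n)
  refine (torusOscillation_le hn ht).trans ?_
  have h1 : 3 ≤ 38 / (n : ℝ) ^ 2 * t := by
    rw [div_mul_eq_mul_div, le_div_iff₀ (by positivity)]; nlinarith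
  have h2 : Real.exp (-(38 / (n : ℝ) ^ 2 * t)) ≤ 0.05 :=
    (Real.exp_le_exp.mpr (by linarith)).trans exp_neg_three_le
  linarith

theorem abs_productHeatKernel_zmod_sub_le_exp (hn : 11 ≤ n) {t : ℝ} (ht : 0.08 * (n : ℝ) ^ 2 ≤ t)
    (x : Fin d → ZMod n) :
    |productHeatKernel (ZMod n) t x - ((n : ℝ) ^ d)⁻¹| ≤
      ((n : ℝ) ^ d)⁻¹ * (2 ^ d * 3) * Real.exp (-(38 / (n : ℝ) ^ 2 * t)) := by
  refine (abs_productHeatKernel_zmod_sub_le t x).trans ?_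
  rw [mul_assoc]
  refine mul_le_mul_of_nonneg_left ?_ (by positivity)
  have h1 := torusOscillation_le_const hn ht
  refine (one_add_pow_sub_one_le (torusOscillation_nonneg t) (by linarith) d).trans ?_
  rw [mul_assoc]
  exact mul_le_mul (by linarith) (torusOscillation_le hn ht) (torusOscillation_nonneg t)
    (by positivity)

open MeasureTheory Set

theorem integrableOn_productHeatKernel_zmod_sub (hn : 11 ≤ n) (x : Fin d → ZMod n) :
    IntegrableOn (fun t => productHeatKernel (ZMod n) t x - ((n : ℝ) ^ d)⁻¹) (Ioi 0) := by
  have hn0 : (0 : ℝ) < n := by exact_mod_cast (by omega : 0 < n)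
  have hc : Continuous fun t => productHeatKernel (ZMod n) t x - ((n : ℝ) ^ d)⁻¹ :=
    (continuous_productHeatKernel_zmod x).sub continuous_const
  rw [← Ioc_union_Ioi_eq_Ioi (by positivity : 0 ≤ 0.08 * (n : ℝ) ^ 2)]
  refine (hc.integrableOn_Ioc).union ?_
  refine Integrable.mono' (((integrableOn_exp_mul_Ioi
    (by have : 0 < 38 / (n : ℝ) ^ 2 := by positivity
        linarith : -(38 / (n : ℝ) ^ 2) < 0) _).const_mul (((n : ℝ) ^ d)⁻¹ * (2 ^ d * 3))))
    hc.aestronglyMeasurable ?_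
  refine (ae_restrict_iff' measurableSet_Ioi).mpr (Filter.Eventually.of_forall fun t ht => ?_)
  rw [Real.norm_eq_abs, neg_mul]
  exact abs_productHeatKernel_zmod_sub_le_exp hn (le_of_lt ht) x

theorem tendsto_productHeatKernel_zmod (hn : 11 ≤ n) (x : Fin d → ZMod n) :
    Filter.Tendsto (fun t => productHeatKernel (ZMod n) t x) Filter.atTop
      (nhds ((n : ℝ) ^ d)⁻¹) := by
  have hn0 : (0 : ℝ) < n := by exact_mod_cast (by omega : 0 < n)
  rw [tendsto_iff_norm_sub_tendsto_zero]
  have h : Filter.Tendsto (fun t : ℝ => ((n : ℝ) ^ d)⁻¹ * (2 ^ d * 3) *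
      Real.exp (-(38 / (n : ℝ) ^ 2 * t))) Filter.atTop (nhds 0) := by
    rw [← mul_zero (((n : ℝ) ^ d)⁻¹ * (2 ^ d * 3))]
    refine Filter.Tendsto.const_mul _ (Real.tendsto_exp_neg_atTop_nhds_zero.comp ?_)
    exact Filter.tendsto_id.const_mul_atTop (by positivity)
  refine squeeze_zero' (Filter.Eventually.of_forall fun t => norm_nonneg _) ?_ h
  filter_upwards [Filter.eventually_ge_atTop (0.08 * (n : ℝ) ^ 2)] with t ht
  exact abs_productHeatKernel_zmod_sub_le_exp hn ht x

/-- The zero-average Green's function as the time integral of the centred heat kernel. -/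
noncomputable def torusGreen (d n : ℕ) (x : Fin d → ZMod n) : ℝ :=
  ∫ t in Ioi (0 : ℝ), (productHeatKernel (ZMod n) t x - ((n : ℝ) ^ d)⁻¹)

theorem torusGreen_neg (x : Fin d → ZMod n) : torusGreen d n (-x) = torusGreen d n x := by
  simp only [torusGreen, productHeatKernel, Pi.neg_apply, cyclicHeatKernel_zmod_neg]

theorem sum_torusGreen (hn : 11 ≤ n) : ∑ x : Fin d → ZMod n, torusGreen d n x = 0 := by
  have hn0 : (n : ℝ) ≠ 0 := by exact_mod_cast (by omega : n ≠ 0)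
  simp only [torusGreen]
  rw [← integral_finsetSum _ fun x _ => integrableOn_productHeatKernel_zmod_sub hn x]
  simp [Finset.sum_sub_distrib, sum_productHeatKernel_zmod, Finset.card_univ, ZMod.card, hn0]

theorem negLaplacian_torusGreen (hn : 11 ≤ n) (x : Fin d → ZMod n) :
    negLaplacian d (ZMod n) (torusGreen d n) x = (if x = 0 then 1 else 0) - ((n : ℝ) ^ d)⁻¹ := by
  have hi := integrableOn_productHeatKernel_zmod_sub (d := d) hn
  have ha (i : Fin d) : IntegrableOn (fun t =>
      (productHeatKernel (ZMod n) t (x + Pi.single i 1) - ((n : ℝ) ^ d)⁻¹) +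
        (productHeatKernel (ZMod n) t (x - Pi.single i 1) - ((n : ℝ) ^ d)⁻¹)) (Ioi 0) :=
    (hi _).add (hi _)
  have hi1 : IntegrableOn (fun t => ∑ i : Fin d,
      ((productHeatKernel (ZMod n) t (x + Pi.single i 1) - ((n : ℝ) ^ d)⁻¹) +
        (productHeatKernel (ZMod n) t (x - Pi.single i 1) - ((n : ℝ) ^ d)⁻¹))) (Ioi 0) :=
    integrable_finsetSum _ fun i _ => ha i
  have e1 (t : ℝ) : negLaplacian d (ZMod n) (productHeatKernel (ZMod n) t) x =
      2 * (d : ℝ) * (productHeatKernel (ZMod n) t x - ((n : ℝ) ^ d)⁻¹) - ∑ i : Fin d,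
      ((productHeatKernel (ZMod n) t (x + Pi.single i 1) - ((n : ℝ) ^ d)⁻¹) +
        (productHeatKernel (ZMod n) t (x - Pi.single i 1) - ((n : ℝ) ^ d)⁻¹)) := by
    simp only [negLaplacian, LinearMap.coe_mk, AddHom.coe_mk, Finset.sum_add_distrib,
      Finset.sum_sub_distrib, Finset.sum_const, Finset.card_univ, Fintype.card_fin, nsmul_eq_mul]
    ring
  have hi2 : IntegrableOn (fun t => negLaplacian d (ZMod n) (productHeatKernel (ZMod n) t) x)
      (Ioi 0) := by
    simp only [e1]
    exact ((hi x).const_mul _).sub hi1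
  have h := integral_Ioi_of_hasDerivAt_of_tendsto
    (continuous_productHeatKernel_zmod x).continuousWithinAt
    (fun t _ => hasDerivAt_productHeatKernel_zmod x t) hi2.neg (tendsto_productHeatKernel_zmod hn x)
  rw [productHeatKernel_zmod_zero_time, integral_neg] at h
  have h2 : negLaplacian d (ZMod n) (torusGreen d n) x =
      ∫ t in Ioi (0 : ℝ), negLaplacian d (ZMod n) (productHeatKernel (ZMod n) t) x := by
    simp only [e1]
    rw [integral_sub ((hi x).const_mul _) hi1, integral_const_mul,
      integral_finsetSum _ fun i _ => ha i]
    simp only [negLaplacian, LinearMap.coe_mk, AddHom.coe_mk]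
    congr 1
    refine Finset.sum_congr rfl fun i _ => ?_
    rw [integral_add (hi _) (hi _)]
    rfl
  linarith

/-- The spectral definition and the time integral are both group inverses of the Laplacian matrix. -/
theorem zeroAvgGreen_eq (hn : 11 ≤ n) (x y : Fin d → ZMod n) :
    zeroAvgGreen d n x y = torusGreen d n (x - y) := by
  set A := torusLaplacianMatrix d n with hA
  set hL := torusLaplacianMatrix_isHermitian d n with hhL
  set U : Matrix (Fin d → ZMod n) (Fin d → ZMod n) ℝ := hL.eigenvectorUnitary.1 with hU
  set E : Matrix (Fin d → ZMod n) (Fin d → ZMod n) ℝ := Matrix.diagonal hL.eigenvalues with hE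
  set F : Matrix (Fin d → ZMod n) (Fin d → ZMod n) ℝ :=
    Matrix.diagonal (fun w => if hL.eigenvalues w = 0 then 0 else 1 / hL.eigenvalues w) with hF
  have hG : zeroAvgGreen d n = U * F * U.transpose := rfl
  have hUU : U.transpose * U = 1 := by
    have := Unitary.coe_star_mul_self hL.eigenvectorUnitary
    rwa [Matrix.star_eq_conjTranspose, Matrix.conjTranspose_eq_transpose_of_trivial] at this
  have hAE : A = U * E * U.transpose := by
    have := hL.spectral_theorem
    rw [Unitary.conjStarAlgAut_apply, Matrix.star_eq_conjTranspose,
      Matrix.conjTranspose_eq_transpose_of_trivial] at this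
    exact this
  have comb (X Y : Matrix (Fin d → ZMod n) (Fin d → ZMod n) ℝ) :
      (U * X * U.transpose) * (U * Y * U.transpose) = U * (X * Y) * U.transpose := by
    calc _ = U * X * (U.transpose * U) * Y * U.transpose := by simp only [Matrix.mul_assoc]
      _ = _ := by rw [hUU]; simp only [Matrix.mul_assoc, Matrix.one_mul]
  set J : Matrix (Fin d → ZMod n) (Fin d → ZMod n) ℝ := Matrix.of fun _ _ => ((n : ℝ) ^ d)⁻¹ with hJ
  set M : Matrix (Fin d → ZMod n) (Fin d → ZMod n) ℝ :=
    Matrix.of fun x y => torusGreen d n (x - y) with hM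
  have hAT : A.transpose = A := by
    have := hL.eq
    rwa [Matrix.conjTranspose_eq_transpose_of_trivial] at this
  have hMT : M.transpose = M := by
    ext x y
    simp only [hM, Matrix.transpose_apply, Matrix.of_apply]
    rw [← torusGreen_neg, neg_sub]
  have hJT : J.transpose = J := rfl
  have hmul (X : Matrix (Fin d → ZMod n) (Fin d → ZMod n) ℝ) (x y : Fin d → ZMod n) :
      (A * X) x y = negLaplacian d (ZMod n) (fun z => X z y) x := by
    have : (A * X) x y = (A.mulVec fun z => X z y) x := rfl
    rw [this, hA, torusLaplacianMatrix, LinearMap.toMatrix'_mulVec]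
  have hAM : A * M = 1 - J := by
    ext x y
    rw [hmul]
    have h := negLaplacian_torusGreen (d := d) hn (x - y)
    simp only [negLaplacian, LinearMap.coe_mk, AddHom.coe_mk] at h ⊢
    simp only [hM, hJ, Matrix.of_apply, Matrix.sub_apply, Matrix.one_apply]
    simp only [sub_eq_zero] at h
    rw [← h]
    congr 1
    refine Finset.sum_congr rfl fun i _ => ?_
    rw [add_sub_right_comm, sub_right_comm]
  have hMA : M * A = 1 - J := by
    have := congrArg Matrix.transpose hAM
    rwa [Matrix.transpose_mul, hMT, hAT, Matrix.transpose_sub, Matrix.transpose_one, hJT] at this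
  have hAJ : A * J = 0 := by
    ext x y
    rw [hmul]
    simp only [negLaplacian, LinearMap.coe_mk, AddHom.coe_mk, hJ, Matrix.of_apply,
      Finset.sum_const, Finset.card_univ, Fintype.card_fin, nsmul_eq_mul, Matrix.zero_apply]
    ring
  have hJA : J * A = 0 := by
    have := congrArg Matrix.transpose hAJ
    rwa [Matrix.transpose_mul, hAT, hJT, Matrix.transpose_zero] at this
  have hJM : J * M = 0 := by
    ext x y
    rw [Matrix.mul_apply]
    simp only [hJ, hM, Matrix.of_apply, Matrix.zero_apply]
    have := (Equiv.subRight y).sum_comp (torusGreen d n)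
    rw [sum_torusGreen hn] at this
    simp only [Equiv.subRight_apply] at this
    rw [← Finset.mul_sum, this, mul_zero]
  have hEF : E * F = F * E := Matrix.commute_diagonal _ _
  have hEFE : E * F * E = E := by
    simp only [hE, hF, Matrix.diagonal_mul_diagonal]
    congr 1
    funext w
    split_ifs with h
    · simp [h]
    · field_simp
  have hFEF : F * E * F = F := by
    simp only [hE, hF, Matrix.diagonal_mul_diagonal]
    congr 1
    funext w
    split_ifs with h
    · simp
    · field_simp
  have : zeroAvgGreen d n = M := by
    refine eq_of_groupInverse (A := A) ?_ ?_ ?_ ?_ ?_ ?_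
    · rw [hG, hAE, comb, comb, hEF]
    · rw [hG, hAE, comb, comb, hEFE]
    · rw [hG, hAE, comb, comb, hFEF]
    · rw [hAM, hMA]
    · rw [hAM, Matrix.sub_mul, Matrix.one_mul, hJA, sub_zero]
    · rw [hMA, Matrix.sub_mul, Matrix.one_mul, hJM, sub_zero]
  rw [this, hM, Matrix.of_apply]

end torus

/-! ### The time integral of the heat kernel on the lattice -/

theorem measurable_cyclicHeatKernel_int (x : ℤ) : Measurable fun t => cyclicHeatKernel ℤ t x := by
  refine measurable_of_tendsto_metrizable' Filter.atTop
    (f := fun (s : Finset (ℕ × ℕ)) t => ∑ p ∈ s, poissonPairWeight t p *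
      (if ((p.1 : ℤ) - p.2) = x then 1 else 0)) (fun s => ?_) ?_
  · unfold poissonPairWeight
    fun_prop
  · rw [tendsto_pi_nhds]
    exact fun t => (summable_poissonPairWeight_ite t _).hasSum

section lattice
variable {d : ℕ}

theorem measurable_productHeatKernel_int (x : Fin d → ℤ) :
    Measurable fun t => productHeatKernel ℤ t x :=
  Finset.measurable_fun_prod _ fun _ _ => measurable_cyclicHeatKernel_int _

theorem productHeatKernel_int_le_one {t : ℝ} (ht : 0 ≤ t) (x : Fin d → ℤ) :
    productHeatKernel ℤ t x ≤ 1 :=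
  Finset.prod_le_one (fun _ _ => cyclicHeatKernel_nonneg ℤ ht _)
    fun _ _ => cyclicHeatKernel_le_one ℤ ht _

theorem productHeatKernel_int_le {t : ℝ} (ht : 0 < t) (x : Fin d → ℤ) :
    productHeatKernel ℤ t x ≤ t ^ (-(d : ℝ) / 2) := by
  have h : ∏ i, cyclicHeatKernel ℤ t (x i) ≤ ∏ _i : Fin d, t ^ (-(1 / 2) : ℝ) := by
    refine Finset.prod_le_prod (fun _ _ => cyclicHeatKernel_nonneg ℤ ht.le _) fun i _ => ?_
    refine (cyclicHeatKernel_int_le ht _).trans ?_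
    rw [Real.rpow_neg ht.le, ← Real.sqrt_eq_rpow, ← one_div]
    gcongr
    norm_num
  rw [Finset.prod_const, Finset.card_univ, Fintype.card_fin, ← Real.rpow_natCast,
    ← Real.rpow_mul ht.le] at h
  refine h.trans_eq ?_
  congr 1
  ring

theorem productHeatKernel_int_le_chernoff {t ρ : ℝ} (ht : 0 < t) (hρ : 0 < ρ) (x : Fin d → ℤ)
    {i : Fin d} (hx : ρ ≤ |(x i : ℝ)|) :
    productHeatKernel ℤ t x ≤ chernoffFactor ρ t * min 1 (0.45 / √t) ^ d := by
  rw [productHeatKernel, ← Finset.mul_prod_erase _ _ (Finset.mem_univ i)]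
  have h1 := cyclicHeatKernel_int_le_chernoff ht hρ (x i) hx
  have h2 : ∏ j ∈ Finset.univ.erase i, cyclicHeatKernel ℤ t (x j) ≤ min 1 (0.45 / √t) ^ (d - 1) := by
    refine (Finset.prod_le_prod (fun _ _ => cyclicHeatKernel_nonneg ℤ ht.le _) fun j _ =>
      le_min (cyclicHeatKernel_le_one ℤ ht.le _) (cyclicHeatKernel_int_le ht _)).trans_eq ?_
    rw [Finset.prod_const, Finset.card_erase_of_mem (Finset.mem_univ i), Finset.card_univ,
      Fintype.card_fin]
  have hm : 0 ≤ min 1 (0.45 / √t) := le_min zero_le_one (by positivity)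
  have hd : d = d - 1 + 1 := by have := i.pos; omega
  calc _ ≤ chernoffFactor ρ t * min 1 (0.45 / √t) * min 1 (0.45 / √t) ^ (d - 1) :=
        mul_le_mul h1 h2 (Finset.prod_nonneg fun _ _ => cyclicHeatKernel_nonneg ℤ ht.le _)
          (mul_nonneg (chernoffFactor_nonneg _ _) hm)
    _ = chernoffFactor ρ t * min 1 (0.45 / √t) ^ (d - 1 + 1) := by ring
    _ = _ := by rw [← hd]

open MeasureTheory Set

theorem integrableOn_Ioc_of_bound {f : ℝ → ℝ} (hf : Measurable f) (T B : ℝ)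
    (h : ∀ t, 0 < t → t ≤ T → |f t| ≤ B) : IntegrableOn f (Ioc 0 T) := by
  refine Integrable.mono' (g := fun _ => B) (integrable_const B) hf.aestronglyMeasurable ?_
  exact (ae_restrict_iff' measurableSet_Ioc).mpr
    (Filter.Eventually.of_forall fun t ht => h t ht.1 ht.2)

theorem abs_setIntegral_Ioc_le {f : ℝ → ℝ} {T B : ℝ} (hT : 0 ≤ T)
    (h : ∀ t, 0 < t → t ≤ T → |f t| ≤ B) : |∫ t in Ioc 0 T, f t| ≤ B * T := by
  have := norm_setIntegral_le_of_norm_le_const (μ := volume) (s := Ioc 0 T) (f := f) (C := B)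
    (by simp) (fun t ht => h t ht.1 ht.2)
  simpa [hT] using this

theorem integrableOn_productHeatKernel_int_Ioi (hd : 3 ≤ d) (x : Fin d → ℤ) {T : ℝ} (hT : 0 < T) :
    IntegrableOn (fun t => productHeatKernel ℤ t x) (Ioi T) := by
  have hd' : (3 : ℝ) ≤ d := by exact_mod_cast hd
  refine Integrable.mono' (integrableOn_Ioi_rpow_of_lt (a := -(d : ℝ) / 2) (by linarith) hT)
    (measurable_productHeatKernel_int x).aestronglyMeasurable ?_
  refine (ae_restrict_iff' measurableSet_Ioi).mpr (Filter.Eventually.of_forall fun t ht => ?_)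
  have ht0 : 0 < t := hT.trans ht
  rw [Real.norm_eq_abs, abs_of_nonneg (productHeatKernel_nonneg ℤ ht0.le x)]
  exact productHeatKernel_int_le ht0 x

theorem integrableOn_productHeatKernel_int (hd : 3 ≤ d) (x : Fin d → ℤ) :
    IntegrableOn (fun t => productHeatKernel ℤ t x) (Ioi 0) := by
  rw [← Ioc_union_Ioi_eq_Ioi zero_le_one]
  refine (integrableOn_Ioc_of_bound (measurable_productHeatKernel_int x) 1 1
    fun t ht _ => ?_).union (integrableOn_productHeatKernel_int_Ioi hd x zero_lt_one)
  rw [abs_of_nonneg (productHeatKernel_nonneg ℤ ht.le x)]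
  exact productHeatKernel_int_le_one ht.le x

/-- The tail `∫_{0.08 R²}^∞ t ^ (-d/2) dt` of the on-diagonal bound is of order `R ^ (2 - d)`. -/
theorem exists_setIntegral_Ioi_le (hd : 3 ≤ d) : ∃ C : ℝ, 0 < C ∧ ∀ R : ℝ, 0 < R →
    ∀ x : Fin d → ℤ, ∫ t in Ioi (0.08 * R ^ 2), productHeatKernel ℤ t x ≤ C * R ^ (2 - (d : ℤ)) := by
  have hd' : (3 : ℝ) ≤ d := by exact_mod_cast hd
  have h1 : 0 < (d : ℝ) / 2 - 1 := by linarith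
  refine ⟨0.08 ^ (1 - (d : ℝ) / 2) / ((d : ℝ) / 2 - 1), by positivity, fun R hR x => ?_⟩
  have hT : 0 < 0.08 * R ^ 2 := by positivity
  calc _ ≤ ∫ t in Ioi (0.08 * R ^ 2), t ^ (-(d : ℝ) / 2) := by
        refine setIntegral_mono_on (integrableOn_productHeatKernel_int_Ioi hd x hT)
          (integrableOn_Ioi_rpow_of_lt (by linarith) hT) measurableSet_Ioi fun t ht => ?_
        exact productHeatKernel_int_le (hT.trans ht) x
    _ = (0.08 * R ^ 2) ^ (1 - (d : ℝ) / 2) / ((d : ℝ) / 2 - 1) := by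
        rw [integral_Ioi_rpow_of_lt (by linarith) hT]
        rw [show -(d : ℝ) / 2 + 1 = -((d : ℝ) / 2 - 1) by ring, neg_div_neg_eq]
        congr 2
        ring
    _ = _ := by
        rw [Real.mul_rpow (by norm_num) (by positivity), ← Real.rpow_natCast R 2,
          ← Real.rpow_mul hR.le, ← Real.rpow_intCast]
        push_cast
        rw [show 2 * (1 - (d : ℝ) / 2) = 2 - d by ring]
        ring

/-- The time integral of the heat kernel of `ℤ ^ d`. -/
noncomputable def heatGreen (d : ℕ) (x : Fin d → ℤ) : ℝ :=
  ∫ t in Ioi (0 : ℝ), productHeatKernel ℤ t x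

theorem heatGreen_nonneg (x : Fin d → ℤ) : 0 ≤ heatGreen d x :=
  setIntegral_nonneg measurableSet_Ioi fun _ ht => productHeatKernel_nonneg ℤ (le_of_lt ht) x

theorem sq_div_pow_eq {R : ℝ} (hR : 0 < R) : R ^ 2 / R ^ d = R ^ (2 - (d : ℤ)) := by
  rw [zpow_sub₀ hR.ne', zpow_natCast]
  norm_cast

/-- Decay of `heatGreen` at infinity: the Chernoff bound is used up to time `0.08 ρ²`, the on-diagonal
bound afterwards. -/
theorem exists_heatGreen_le (hd : 3 ≤ d) : ∃ C : ℝ, 0 < C ∧ ∀ ρ : ℝ, 0 < ρ → ∀ x : Fin d → ℤ,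
    (∃ i, ρ ≤ |(x i : ℝ)|) → heatGreen d x ≤ C * ρ ^ (2 - (d : ℤ)) := by
  obtain ⟨C₁, hC₁, h₁⟩ := exists_setIntegral_Ioi_le hd
  obtain ⟨C₂, hC₂, h₂⟩ := exists_chernoffFactor_mul_pow_le d (K := 0.45) (by norm_num)
  refine ⟨C₂ * 0.08 + C₁, by positivity, fun ρ hρ x ⟨i, hi⟩ => ?_⟩
  have hT : 0 < 0.08 * ρ ^ 2 := by positivity
  have hint := integrableOn_productHeatKernel_int hd x
  rw [heatGreen, ← Ioc_union_Ioi_eq_Ioi hT.le, setIntegral_union (Ioc_disjoint_Ioi le_rfl)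
    measurableSet_Ioi (hint.mono_set Ioc_subset_Ioi_self) (hint.mono_set (Ioi_subset_Ioi hT.le)),
    add_mul]
  refine add_le_add ?_ (h₁ ρ hρ x)
  have := abs_setIntegral_Ioc_le (f := fun t => productHeatKernel ℤ t x) (B := C₂ / ρ ^ d) hT.le
    fun t ht _ => by
      rw [abs_of_nonneg (productHeatKernel_nonneg ℤ ht.le x)]
      exact (productHeatKernel_int_le_chernoff ht hρ x hi).trans (h₂ ρ t _ hρ ht
        (le_min zero_le_one (by positivity)) (min_le_left _ _) (min_le_right _ _))
  refine (le_abs_self _).trans (this.trans_eq ?_)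
  rw [← sq_div_pow_eq hρ]
  ring

end lattice

/-! ### Comparison of the torus with the lattice -/

theorem prod_sub_prod_le {ι : Type*} (s : Finset ι) {a b : ι → ℝ} {D δ : ℝ} (hδ : 0 ≤ δ)
    (hD : 0 ≤ D) (hb : ∀ i ∈ s, 0 ≤ b i) (hba : ∀ i ∈ s, b i ≤ a i) (haD : ∀ i ∈ s, a i ≤ D)
    (hab : ∀ i ∈ s, a i - b i ≤ δ * D) :
    ∏ i ∈ s, a i - ∏ i ∈ s, b i ≤ s.card * δ * D ^ s.card := by
  classical
  induction s using Finset.induction_on with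
  | empty => simp
  | insert c s hc ih =>
    have h1 := ih (fun i hi => hb i (Finset.mem_insert_of_mem hi))
      (fun i hi => hba i (Finset.mem_insert_of_mem hi))
      (fun i hi => haD i (Finset.mem_insert_of_mem hi))
      (fun i hi => hab i (Finset.mem_insert_of_mem hi))
    have hc' := Finset.mem_insert_self c s
    rw [Finset.prod_insert hc, Finset.prod_insert hc, Finset.card_insert_of_notMem hc]
    have h2 : ∏ i ∈ s, a i ≤ D ^ s.card := by
      refine (Finset.prod_le_prod (fun i hi => ?_) fun i hi => haD i
        (Finset.mem_insert_of_mem hi)).trans_eq (Finset.prod_const _)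
      exact (hb i (Finset.mem_insert_of_mem hi)).trans (hba i (Finset.mem_insert_of_mem hi))
    have h3 : 0 ≤ ∏ i ∈ s, a i := Finset.prod_nonneg fun i hi =>
      (hb i (Finset.mem_insert_of_mem hi)).trans (hba i (Finset.mem_insert_of_mem hi))
    have h4 : 0 ≤ s.card * δ * D ^ s.card := by positivity
    calc _ = (a c - b c) * ∏ i ∈ s, a i + b c * (∏ i ∈ s, a i - ∏ i ∈ s, b i) := by ring
      _ ≤ (δ * D) * D ^ s.card + D * (s.card * δ * D ^ s.card) := by
          refine add_le_add (mul_le_mul (hab c hc') h2 h3 (by positivity)) ?_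
          exact (mul_le_mul_of_nonneg_left h1 (hb c hc')).trans
            (mul_le_mul_of_nonneg_right ((hba c hc').trans (haD c hc')) h4)
      _ = _ := by push_cast; ring

section torus
variable {d : ℕ}
open MeasureTheory Set

theorem productHeatKernel_int_le_zmod {n : ℕ} {t : ℝ} (ht : 0 ≤ t) (y : Fin d → ℤ) :
    productHeatKernel ℤ t y ≤ productHeatKernel (ZMod n) t (torusProj d n y) :=
  Finset.prod_le_prod (fun _ _ => cyclicHeatKernel_nonneg ℤ ht _)
    fun i _ => cyclicHeatKernel_int_le_zmod ht (y i)

theorem productHeatKernel_zmod_sub_int_le {n : ℕ} [NeZero n] {t ρ : ℝ} (ht : 0 < t) (hρ : 0 < ρ)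
    (y : Fin d → ℤ) (hy : ∀ i, ∀ m : ℤ, (m : ZMod n) = y i → m ≠ y i → ρ ≤ |(m : ℝ)|) :
    productHeatKernel (ZMod n) t (torusProj d n y) - productHeatKernel ℤ t y ≤
      d * (2 * chernoffFactor ρ t) * torusReturn n t ^ d := by
  have := prod_sub_prod_le Finset.univ (a := fun i => cyclicHeatKernel (ZMod n) t (y i : ZMod n))
    (b := fun i => cyclicHeatKernel ℤ t (y i)) (D := torusReturn n t) (δ := 2 * chernoffFactor ρ t)
    (mul_nonneg zero_le_two (chernoffFactor_nonneg _ _)) (torusReturn_nonneg t)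
    (fun i _ => cyclicHeatKernel_nonneg ℤ ht.le _) (fun i _ => cyclicHeatKernel_int_le_zmod ht.le _)
    (fun i _ => cyclicHeatKernel_zmod_le _ _)
    (fun i _ => cyclicHeatKernel_zmod_sub_int_le_chernoff ht hρ (y i) (hy i))
  simpa [productHeatKernel, torusProj] using this

/-- Up to time `0.08 n²` the two kernels and the centring constant differ by `O(n ^ (-d))` pointwise;
afterwards the centred torus kernel and the lattice kernel are integrable separately. -/
theorem exists_abs_torusGreen_sub_heatGreen_le (hd : 3 ≤ d) : ∃ C : ℝ, 0 < C ∧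
    ∀ (n : ℕ) [NeZero n], 25 ≤ n → ∀ y ∈ fundamentalBox d n,
      |torusGreen d n (torusProj d n y) - heatGreen d y| ≤ C * (n : ℝ) ^ (2 - (d : ℤ)) := by
  obtain ⟨C₁, hC₁, h₁⟩ := exists_setIntegral_Ioi_le hd
  obtain ⟨C₂, hC₂, h₂⟩ := exists_chernoffFactor_mul_pow_le d (K := 0.5) (by norm_num)
  refine ⟨(d * 2 * C₂ * 2 ^ d + 1) * 0.08 + (2 ^ d * 3 + C₁), by positivity, fun n _ hn y hy => ?_⟩
  have hn0 : (0 : ℝ) < n := by exact_mod_cast (by omega : 0 < n)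
  have hT : 0 < 0.08 * (n : ℝ) ^ 2 := by positivity
  have hi1 := integrableOn_productHeatKernel_zmod_sub (by omega : 11 ≤ n) (torusProj d n y)
  have hi2 := integrableOn_productHeatKernel_int hd y
  have hi : IntegrableOn (fun t => (productHeatKernel (ZMod n) t (torusProj d n y) -
      ((n : ℝ) ^ d)⁻¹) - productHeatKernel ℤ t y) (Ioi 0) := hi1.sub hi2
  have e : torusGreen d n (torusProj d n y) - heatGreen d y = ∫ t in Ioi (0 : ℝ),
      ((productHeatKernel (ZMod n) t (torusProj d n y) - ((n : ℝ) ^ d)⁻¹) -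
        productHeatKernel ℤ t y) := (integral_sub hi1 hi2).symm
  rw [e, ← Ioc_union_Ioi_eq_Ioi hT.le, setIntegral_union (Ioc_disjoint_Ioi le_rfl)
    measurableSet_Ioi (hi.mono_set Ioc_subset_Ioi_self) (hi.mono_set (Ioi_subset_Ioi hT.le)),
    add_mul]
  refine (abs_add_le _ _).trans (add_le_add ?_ ?_)
  · refine (abs_setIntegral_Ioc_le (B := (d * 2 * C₂ * 2 ^ d + 1) / (n : ℝ) ^ d) hT.le
      fun t ht htn => ?_).trans_eq ?_
    · have h3 := productHeatKernel_zmod_sub_int_le ht (by positivity : 0 < (n : ℝ) / 2) y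
        fun i m hm hm' => half_le_abs_of_intCast_eq hm hm' (hy i).1 (hy i).2
      have h4 := h₂ (n / 2) t (torusReturn n t) (by positivity) ht (torusReturn_nonneg t)
        (torusReturn_le_one ht.le) (torusReturn_le_of_le hn ht htn)
      have h5 := productHeatKernel_int_le_zmod (n := n) ht.le y
      rw [div_pow, div_div_eq_mul_div] at h4
      have h6 : d * (2 * chernoffFactor (n / 2) t) * torusReturn n t ^ d ≤
          d * 2 * (C₂ * 2 ^ d / n ^ d) := by
        calc _ = d * 2 * (chernoffFactor (n / 2) t * torusReturn n t ^ d) := by ring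
          _ ≤ _ := by gcongr
      have h7 : 0 ≤ ((n : ℝ) ^ d)⁻¹ := by positivity
      have h8 : (d * 2 * C₂ * 2 ^ d + 1) / (n : ℝ) ^ d =
          d * 2 * (C₂ * 2 ^ d / n ^ d) + ((n : ℝ) ^ d)⁻¹ := by ring
      rw [abs_le, h8]
      have h9 : 0 ≤ d * 2 * (C₂ * 2 ^ d / (n : ℝ) ^ d) := by positivity
      constructor <;> linarith
    · rw [← sq_div_pow_eq hn0]; ring
  · rw [integral_sub (hi1.mono_set (Ioi_subset_Ioi hT.le)) (hi2.mono_set (Ioi_subset_Ioi hT.le)),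
      add_mul]
    refine (abs_sub _ _).trans (add_le_add ?_ ?_)
    · have hneg : -(38 / (n : ℝ) ^ 2) < 0 := by
        have : 0 < 38 / (n : ℝ) ^ 2 := by positivity
        linarith
      calc _ ≤ ∫ t in Ioi (0.08 * (n : ℝ) ^ 2), ((n : ℝ) ^ d)⁻¹ * (2 ^ d * 3) *
            Real.exp (-(38 / (n : ℝ) ^ 2) * t) := by
            rw [← Real.norm_eq_abs]
            refine norm_integral_le_of_norm_le ((integrableOn_exp_mul_Ioi hneg _).const_mul _) ?_
            refine (ae_restrict_iff' measurableSet_Ioi).mpr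
              (Filter.Eventually.of_forall fun t ht => ?_)
            rw [Real.norm_eq_abs, neg_mul]
            exact abs_productHeatKernel_zmod_sub_le_exp (by omega) (le_of_lt ht) _
        _ = ((n : ℝ) ^ d)⁻¹ * (2 ^ d * 3) *
            ((n : ℝ) ^ 2 / 38 * Real.exp (-(38 / (n : ℝ) ^ 2) * (0.08 * (n : ℝ) ^ 2))) := by
            rw [integral_const_mul, integral_exp_mul_Ioi hneg]
            congr 1
            field_simp
        _ ≤ ((n : ℝ) ^ d)⁻¹ * (2 ^ d * 3) * ((n : ℝ) ^ 2 / 1 * 1) := by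
            gcongr
            · norm_num
            · rw [Real.exp_le_one_iff]
              nlinarith
        _ = _ := by rw [← sq_div_pow_eq hn0]; ring
    · rw [abs_of_nonneg (setIntegral_nonneg measurableSet_Ioi fun t ht =>
        productHeatKernel_nonneg ℤ (hT.trans ht).le y)]
      exact h₁ n hn0 y

end torus

/-! ### The Poisson equation on the lattice -/

section lattice
variable {d : ℕ}
open Filter Topology

theorem mem_fundamentalBox_of_lt {n : ℕ} {y : Fin d → ℤ} (h : 2 * ∑ i, |y i| < n) :
    y ∈ fundamentalBox d n := by
  intro i
  have h1 : |y i| ≤ ∑ i, |y i| := Finset.single_le_sum (fun i _ => abs_nonneg (y i))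
    (Finset.mem_univ i)
  have h2 : 2 * |(y i : ℝ)| < n := by exact_mod_cast (by omega : 2 * |y i| < n)
  have h3 := abs_lt.mp (by linarith : |(y i : ℝ)| < n / 2)
  exact ⟨h3.1.le, h3.2⟩

theorem eventually_mem_fundamentalBox (y : Fin d → ℤ) :
    ∀ᶠ m : ℕ in atTop, y ∈ fundamentalBox d (m + 1) := by
  filter_upwards [eventually_ge_atTop (2 * ∑ i, |y i|).toNat] with m hm
  refine mem_fundamentalBox_of_lt ?_
  push_cast
  omega

theorem tendsto_zpow_two_sub (hd : 3 ≤ d) :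
    Tendsto (fun m : ℕ => ((m + 1 : ℕ) : ℝ) ^ (2 - (d : ℤ))) atTop (𝓝 0) := by
  have h : Tendsto (fun m : ℕ => ((m + 1 : ℕ) : ℝ)) atTop atTop :=
    tendsto_natCast_atTop_atTop.comp (tendsto_add_atTop_nat 1)
  exact (tendsto_zpow_atTop_zero (by omega)).comp h

theorem tendsto_torusGreen (hd : 3 ≤ d) (y : Fin d → ℤ) :
    Tendsto (fun m : ℕ => torusGreen d (m + 1) (torusProj d (m + 1) y)) atTop
      (𝓝 (heatGreen d y)) := by
  obtain ⟨C, -, h⟩ := exists_abs_torusGreen_sub_heatGreen_le hd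
  rw [tendsto_iff_norm_sub_tendsto_zero]
  have h0 := (tendsto_zpow_two_sub hd).const_mul C
  rw [mul_zero] at h0
  refine squeeze_zero' (Eventually.of_forall fun _ => norm_nonneg _) ?_ h0
  filter_upwards [eventually_mem_fundamentalBox y, eventually_ge_atTop 25] with m hm hm'
  exact h (m + 1) (by omega) y hm

theorem torusProj_add (n : ℕ) (x y : Fin d → ℤ) :
    torusProj d n (x + y) = torusProj d n x + torusProj d n y := by
  funext i; simp [torusProj]

theorem torusProj_sub (n : ℕ) (x y : Fin d → ℤ) :
    torusProj d n (x - y) = torusProj d n x - torusProj d n y := by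
  funext i; simp [torusProj]

theorem torusProj_single (n : ℕ) (i : Fin d) :
    torusProj d n (Pi.single i 1) = Pi.single i 1 := by
  funext j
  by_cases h : j = i
  · subst h; simp [torusProj]
  · simp [torusProj, h]

theorem torusProj_eq_zero_iff {n : ℕ} {x : Fin d → ℤ} (hn : 0 < n) (hx : x ∈ fundamentalBox d n) :
    torusProj d n x = 0 ↔ x = 0 := by
  refine ⟨fun h => ?_, fun h => by subst h; funext i; simp [torusProj]⟩
  have hn' : (0 : ℝ) < n := by exact_mod_cast hn
  funext i
  by_contra h0
  have h1 := le_abs_of_intCast_eq_zero (n := n) (x i) (by simpa [torusProj] using congrFun h i) h0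
  have h2 : |(x i : ℝ)| ≤ n / 2 := abs_le.mpr ⟨(hx i).1, (hx i).2.le⟩
  linarith

/-- The Poisson equation on `ℤ ^ d`, as the limit of the one on the tori. -/
theorem negLaplacian_heatGreen (hd : 3 ≤ d) (x : Fin d → ℤ) :
    negLaplacian d ℤ (heatGreen d) x = if x = 0 then 1 else 0 := by
  have h1 : Tendsto (fun m : ℕ => negLaplacian d (ZMod (m + 1)) (torusGreen d (m + 1))
      (torusProj d (m + 1) x)) atTop (𝓝 (negLaplacian d ℤ (heatGreen d) x)) := by
    simp only [negLaplacian, LinearMap.coe_mk, AddHom.coe_mk]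
    refine ((tendsto_torusGreen hd x).const_mul _).sub (tendsto_finsetSum _ fun i _ => ?_)
    refine Tendsto.add ?_ ?_
    · have := tendsto_torusGreen hd (x + Pi.single i 1)
      simpa only [torusProj_add, torusProj_single] using this
    · have := tendsto_torusGreen hd (x - Pi.single i 1)
      simpa only [torusProj_sub, torusProj_single] using this
  have h2 : Tendsto (fun m : ℕ => (if x = 0 then (1 : ℝ) else 0) - (((m + 1 : ℕ) : ℝ) ^ d)⁻¹) atTop
      (𝓝 ((if x = 0 then (1 : ℝ) else 0) - 0)) := by
    refine tendsto_const_nhds.sub (Tendsto.inv_tendsto_atTop ?_)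
    exact (tendsto_pow_atTop (by omega : d ≠ 0)).comp
      (tendsto_natCast_atTop_atTop.comp (tendsto_add_atTop_nat 1))
  rw [sub_zero] at h2
  refine tendsto_nhds_unique (h1.congr' ?_) h2
  filter_upwards [eventually_mem_fundamentalBox x, eventually_ge_atTop 25] with m hm hm'
  rw [negLaplacian_torusGreen (by omega)]
  congr 1
  exact if_congr (torusProj_eq_zero_iff (by omega) hm) rfl rfl

/-! ### Simple random walk on the lattice -/

theorem heatGreen_neg (x : Fin d → ℤ) : heatGreen d (-x) = heatGreen d x := by
  simp only [heatGreen, productHeatKernel, Pi.neg_apply, cyclicHeatKernel_int_neg]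

/-- The transition operator of simple random walk on `ℤ ^ d`. -/
noncomputable def walkAverage (d : ℕ) (f : (Fin d → ℤ) → ℝ) (x : Fin d → ℤ) : ℝ :=
  1 / (2 * (d : ℝ)) * ∑ i : Fin d, (f (x + Pi.single i 1) + f (x - Pi.single i 1))

theorem walkAverage_mono {f g : (Fin d → ℤ) → ℝ} (h : ∀ x, f x ≤ g x) (x : Fin d → ℤ) :
    walkAverage d f x ≤ walkAverage d g x := by
  unfold walkAverage
  gcongr <;> exact h _

theorem walkAverage_add (f g : (Fin d → ℤ) → ℝ) (x : Fin d → ℤ) :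
    walkAverage d (fun z => f z + g z) x = walkAverage d f x + walkAverage d g x := by
  simp only [walkAverage, ← mul_add, ← Finset.sum_add_distrib]
  congr 1
  exact Finset.sum_congr rfl fun i _ => by ring

theorem walkAverage_mul_left (c : ℝ) (f : (Fin d → ℤ) → ℝ) (x : Fin d → ℤ) :
    walkAverage d (fun z => c * f z) x = c * walkAverage d f x := by
  simp only [walkAverage, ← mul_add, ← Finset.mul_sum]
  ring

theorem walkAverage_const (hd : d ≠ 0) (c : ℝ) (x : Fin d → ℤ) :
    walkAverage d (fun _ => c) x = c := by
  have : (d : ℝ) ≠ 0 := by exact_mod_cast hd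
  simp only [walkAverage, Finset.sum_const, Finset.card_univ, Fintype.card_fin, nsmul_eq_mul]
  field_simp
  ring

theorem walkAverage_sum {ι : Type*} (s : Finset ι) (f : ι → (Fin d → ℤ) → ℝ) (x : Fin d → ℤ) :
    walkAverage d (fun z => ∑ i ∈ s, f i z) x = ∑ i ∈ s, walkAverage d (f i) x := by
  classical
  induction s using Finset.induction_on with
  | empty => simp [walkAverage]
  | insert a s ha ih =>
    simp only [Finset.sum_insert ha]
    rw [walkAverage_add, ih]

theorem srwProb_succ (k : ℕ) (x y : Fin d → ℤ) :
    srwProb d (k + 1) x y = walkAverage d (fun z => srwProb d k z y) x := rfl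

theorem srwProb_nonneg (k : ℕ) (x y : Fin d → ℤ) : 0 ≤ srwProb d k x y := by
  induction k generalizing x with
  | zero => unfold srwProb; split_ifs <;> simp
  | succ k ih =>
    rw [srwProb_succ]
    exact mul_nonneg (by positivity) (Finset.sum_nonneg fun i _ => add_nonneg (ih _) (ih _))

/-- What is left of the potential after the first `K` steps of the walk. -/
noncomputable def greenRemainder (d : ℕ) (y : Fin d → ℤ) (K : ℕ) (x : Fin d → ℤ) : ℝ :=
  heatGreen d (x - y) + -(1 / (2 * (d : ℝ))) * ∑ k ∈ Finset.range K, srwProb d k x y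

theorem heatGreen_eq_add_walkAverage (hd : 3 ≤ d) (x y : Fin d → ℤ) :
    heatGreen d (x - y) = 1 / (2 * (d : ℝ)) * srwProb d 0 x y +
      walkAverage d (fun z => heatGreen d (z - y)) x := by
  have hd0 : (d : ℝ) ≠ 0 := by exact_mod_cast (by omega : d ≠ 0)
  have h := negLaplacian_heatGreen hd (x - y)
  simp only [negLaplacian, LinearMap.coe_mk, AddHom.coe_mk, sub_eq_zero (a := x)] at h
  have e : ∀ i : Fin d, heatGreen d (x + Pi.single i 1 - y) + heatGreen d (x - Pi.single i 1 - y) =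
      heatGreen d (x - y + Pi.single i 1) + heatGreen d (x - y - Pi.single i 1) := fun i => by
    rw [add_sub_right_comm, sub_right_comm]
  simp only [walkAverage, srwProb, e]
  rw [← mul_add, ← h]
  field_simp
  ring

/-- The remainder after `K` steps is the `K`-fold average of `heatGreen`. -/
theorem greenRemainder_succ (hd : 3 ≤ d) (y : Fin d → ℤ) (K : ℕ) (x : Fin d → ℤ) :
    greenRemainder d y (K + 1) x = walkAverage d (greenRemainder d y K) x := by
  have e : walkAverage d (greenRemainder d y K) x = walkAverage d (fun z => heatGreen d (z - y)) x +
      -(1 / (2 * (d : ℝ))) * ∑ k ∈ Finset.range K, srwProb d (k + 1) x y := by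
    simp only [srwProb_succ]
    rw [← walkAverage_sum, ← walkAverage_mul_left, ← walkAverage_add]
    rfl
  rw [e, greenRemainder, heatGreen_eq_add_walkAverage hd, Finset.sum_range_succ']
  ring

theorem greenRemainder_nonneg (hd : 3 ≤ d) (y : Fin d → ℤ) (K : ℕ) (x : Fin d → ℤ) :
    0 ≤ greenRemainder d y K x := by
  induction K generalizing x with
  | zero => simpa [greenRemainder] using heatGreen_nonneg _
  | succ K ih =>
    rw [greenRemainder_succ hd]
    have h := walkAverage_mono (f := fun _ => 0) ih x
    rwa [walkAverage_const (by omega)] at h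

theorem summable_srwProb (hd : 3 ≤ d) (x y : Fin d → ℤ) : Summable fun k => srwProb d k x y := by
  refine summable_of_sum_range_le (c := 2 * d * heatGreen d (x - y))
    (fun k => srwProb_nonneg k x y) fun K => ?_
  have hd0 : (0 : ℝ) < d := by exact_mod_cast (by omega : 0 < d)
  have h := greenRemainder_nonneg hd y K x
  have e : 2 * d * greenRemainder d y K x = 2 * d * heatGreen d (x - y) -
      ∑ k ∈ Finset.range K, srwProb d k x y := by
    rw [greenRemainder]; field_simp; ring
  have : 0 ≤ 2 * d * greenRemainder d y K x := by positivity
  linarith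

theorem exists_finset_heatGreen_le (hd : 3 ≤ d) (y : Fin d → ℤ) {ε : ℝ} (hε : 0 < ε) :
    ∃ F : Finset (Fin d → ℤ), ∀ x ∉ F, heatGreen d (x - y) ≤ ε := by
  obtain ⟨C, hC, h⟩ := exists_heatGreen_le hd
  have h0 := (tendsto_zpow_two_sub hd).const_mul C
  rw [mul_zero] at h0
  obtain ⟨m, hm⟩ := (h0.eventually_le_const hε).exists
  refine ⟨Fintype.piFinset fun i => Finset.Icc (y i - m) (y i + m), fun x hx => ?_⟩
  simp only [Fintype.mem_piFinset, Finset.mem_Icc, not_forall] at hx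
  obtain ⟨i, hi⟩ := hx
  refine (h ((m + 1 : ℕ) : ℝ) (by positivity) (x - y) ⟨i, ?_⟩).trans hm
  have : ((m + 1 : ℕ) : ℤ) ≤ |(x - y) i| := by
    rw [Pi.sub_apply, le_abs]; push_cast; omega
  exact_mod_cast this

/-- The remainder is dominated by `ε` plus multiples of transition probabilities into a finite set,
and these vanish in the limit because they are summable. -/
theorem tendsto_greenRemainder (hd : 3 ≤ d) (x y : Fin d → ℤ) :
    Tendsto (fun K => greenRemainder d y K x) atTop (𝓝 0) := by
  rw [Metric.tendsto_atTop]
  intro ε hε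
  obtain ⟨F, hF⟩ := exists_finset_heatGreen_le hd y (half_pos hε)
  have key (K : ℕ) (x : Fin d → ℤ) : greenRemainder d y K x ≤
      ε / 2 + ∑ z ∈ F, heatGreen d (z - y) * srwProb d K x z := by
    induction K generalizing x with
    | zero =>
      simp only [greenRemainder, srwProb, Finset.range_zero, Finset.sum_empty, mul_zero, add_zero,
        mul_ite, mul_one, Finset.sum_ite_eq]
      split_ifs with hx
      · linarith
      · rw [add_zero]; exact hF x hx
    | succ K ih =>
      rw [greenRemainder_succ hd]
      refine (walkAverage_mono ih x).trans_eq ?_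
      rw [walkAverage_add, walkAverage_const (by omega), walkAverage_sum]
      simp only [walkAverage_mul_left, srwProb_succ]
  have h0 : Tendsto (fun K => ∑ z ∈ F, heatGreen d (z - y) * srwProb d K x z) atTop
      (𝓝 (∑ z ∈ F, heatGreen d (z - y) * 0)) :=
    tendsto_finsetSum _ fun z _ => (summable_srwProb hd x z).tendsto_atTop_zero.const_mul _
  simp only [mul_zero, Finset.sum_const_zero] at h0
  obtain ⟨K₀, hK₀⟩ := eventually_atTop.mp (h0.eventually_lt_const (half_pos hε))
  refine ⟨K₀, fun K hK => ?_⟩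
  rw [Real.dist_eq, sub_zero, abs_of_nonneg (greenRemainder_nonneg hd y K x)]
  linarith [key K x, hK₀ K hK]

theorem latticeGreen_eq (hd : 3 ≤ d) (x y : Fin d → ℤ) :
    latticeGreen d x y = heatGreen d (x - y) := by
  have h1 := (summable_srwProb hd x y).hasSum.tendsto_sum_nat.const_mul (-(1 / (2 * (d : ℝ))))
  have h2 := (h1.const_add (heatGreen d (x - y)))
  have h3 := tendsto_nhds_unique h2 (tendsto_greenRemainder hd x y)
  rw [latticeGreen]
  linarith

theorem exists_le_abs_of_le_latticeNorm (hd : 3 ≤ d) {r : ℝ} (hr : 0 < r) {y : Fin d → ℤ}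
    (h : r ≤ latticeNorm y) : ∃ i, r / d ≤ |(y i : ℝ)| := by
  have hd0 : (1 : ℝ) < d := by exact_mod_cast (by omega : 1 < d)
  by_contra! hlt
  have h1 : ∑ i, (y i : ℝ) ^ 2 ≤ ∑ _i : Fin d, (r / d) ^ 2 := Finset.sum_le_sum fun i _ => by
    rw [← sq_abs]; exact pow_le_pow_left₀ (abs_nonneg _) (hlt i).le 2
  rw [Finset.sum_const, Finset.card_univ, Fintype.card_fin, nsmul_eq_mul] at h1
  have h2 : r ^ 2 ≤ ∑ i, (y i : ℝ) ^ 2 := by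
    rw [latticeNorm] at h
    exact (Real.le_sqrt' hr).mp h
  have h3 : (d : ℝ) * (r / d) ^ 2 = r ^ 2 / d := by field_simp
  have h4 : r ^ 2 / d < r ^ 2 := div_lt_self (by positivity) hd0
  linarith

end lattice

/-! ### The sign in dimension three -/

section signThree
open MeasureTheory Set Filter Topology

theorem mul_exp_neg_div_le {b t : ℝ} (hb : 0 < b) (ht : 0 < t) :
    b / t ^ 2 * Real.exp (-(b / t)) ≤ 2 / b := by
  have h := Real.quadratic_le_exp_of_nonneg (x := b / t) (by positivity)
  have h1 : 0 < b / t := by positivity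
  rw [Real.exp_neg, ← div_eq_mul_inv, div_le_iff₀ (Real.exp_pos _)]
  calc b / t ^ 2 = 2 / b * ((b / t) ^ 2 / 2) := by field_simp
    _ ≤ _ := by gcongr; linarith

theorem integrableOn_mul_exp_neg_div {b : ℝ} (hb : 0 < b) (T : ℝ) :
    IntegrableOn (fun t => b / t ^ 2 * Real.exp (-(b / t))) (Ioc 0 T) :=
  integrableOn_Ioc_of_bound (by fun_prop) T (2 / b) fun t ht _ => by
    rw [abs_of_nonneg (by positivity)]; exact mul_exp_neg_div_le hb ht

theorem setIntegral_mul_exp_neg_div {b T : ℝ} (hb : 0 < b) (hT : 0 < T) :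
    ∫ t in Ioc 0 T, b / t ^ 2 * Real.exp (-(b / t)) = Real.exp (-(b / T)) := by
  have hd (t : ℝ) (ht : 0 < t) : HasDerivAt (fun t => Real.exp (-(b / t)))
      (b / t ^ 2 * Real.exp (-(b / t))) t := by
    have h : HasDerivAt (fun t => Real.exp (-b * t⁻¹))
        (Real.exp (-b * t⁻¹) * (-b * -(t ^ 2)⁻¹)) t :=
      ((hasDerivAt_inv ht.ne').const_mul (-b)).exp
    simp only [neg_mul, ← div_eq_mul_inv, neg_div] at h
    refine h.congr_deriv ?_
    ring
  have h0 : Tendsto (fun t : ℝ => Real.exp (-(b / t))) (𝓝[>] 0) (𝓝 0) := by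
    have h : Tendsto (fun t : ℝ => b * t⁻¹) (𝓝[>] 0) atTop :=
      tendsto_inv_nhdsGT_zero.const_mul_atTop hb
    exact (Real.tendsto_exp_neg_atTop_nhds_zero.comp h).congr fun t => by
      rw [Function.comp_apply, div_eq_mul_inv]
  have := intervalIntegral.integral_eq_sub_of_hasDerivAt_of_tendsto hT
    (fun t ht => hd t ht.1)
    ((intervalIntegrable_iff_integrableOn_Ioc_of_le hT.le).mpr (integrableOn_mul_exp_neg_div hb T))
    h0 ((hd T hT).continuousAt.tendsto.mono_left nhdsWithin_le_nhds)
  rw [← intervalIntegral.integral_of_le hT.le, this, sub_zero]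

/-- The size of `n` comes from bounding the exponential below by its fourth-order Taylor term. -/
theorem exp_neg_linear_le {n : ℝ} (hn : 20000000 ≤ n) :
    Real.exp (-(0.12 * n)) * (6 * 0.08 * n ^ 3) ≤ 0.005 := by
  have h := Real.pow_div_factorial_le_exp (0.12 * n) (by positivity) 4
  have h2 : (0.12 * n) ^ 4 / (Nat.factorial 4 : ℕ) = (0.12 ^ 4 / 24 * n) * n ^ 3 := by
    norm_num [Nat.factorial]; ring
  rw [h2] at h
  rw [Real.exp_neg, ← div_eq_inv_mul, div_le_iff₀ (Real.exp_pos _)]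
  have h3 : 0 < n ^ 3 := by positivity
  nlinarith

variable {n : ℕ} [NeZero n]

/-- The wrap-around part of the heat kernel at the origin up to time `0.08 n²`. The two terms come
from the two regimes of the Chernoff rate; in the second, `t ^ (-3/2) ≤ √0.08 * n * t ^ (-2)` makes
the bound an exact derivative. -/
theorem wrapping_pointwise_le (hn : 25 ≤ n) {t : ℝ} (ht : 0 < t) (htn : t ≤ 0.08 * (n : ℝ) ^ 2) :
    productHeatKernel (ZMod n) t (torusProj 3 n 0) - productHeatKernel ℤ t (0 : Fin 3 → ℤ) ≤
      6 * Real.exp (-(0.12 * n)) + 0.75 * (√0.08 * n / (0.24 * n ^ 2)) *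
        (0.24 * n ^ 2 / t ^ 2 * Real.exp (-(0.24 * n ^ 2 / t))) := by
  have hn0 : (0 : ℝ) < n := by exact_mod_cast (by omega : 0 < n)
  have h := productHeatKernel_zmod_sub_int_le ht hn0 (0 : Fin 3 → ℤ)
    fun i m hm hm' => le_abs_of_intCast_eq_zero m hm hm'
  refine h.trans ?_
  have hD0 := torusReturn_nonneg (n := n) t
  have hD1 := torusReturn_le_one (n := n) ht.le
  have hD := torusReturn_le_of_le hn ht htn
  push_cast
  rcases le_total ((n : ℝ) / 2) ((n : ℝ) ^ 2 / t) with h1 | h1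
  · have e : chernoffFactor n t = Real.exp (-(0.12 * n)) := by
      rw [chernoffFactor, min_eq_left h1]; congr 2; ring
    rw [e]
    refine le_add_of_le_of_nonneg ?_ (by positivity)
    have := pow_le_one₀ (n := 3) hD0 hD1
    nlinarith [Real.exp_pos (-(0.12 * n))]
  · have e : chernoffFactor n t = Real.exp (-(0.24 * n ^ 2 / t)) := by
      rw [chernoffFactor, min_eq_right h1]; congr 2; ring
    rw [e]
    refine le_add_of_nonneg_of_le (by positivity) ?_
    have h2 : torusReturn n t ^ 3 ≤ 0.125 * (√t / t ^ 2) := by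
      calc _ ≤ (0.5 / √t) ^ 3 := pow_le_pow_left₀ hD0 hD 3
        _ = _ := by
          have hs : √t ^ 2 = t := Real.sq_sqrt ht.le
          have hs0 : √t ≠ 0 := by positivity
          have : t ^ 2 = √t ^ 4 := by nth_rewrite 1 [← hs]; ring
          rw [this]
          field_simp
          norm_num
    have h3 : √t ≤ √0.08 * n := by
      calc √t ≤ √(0.08 * (n : ℝ) ^ 2) := Real.sqrt_le_sqrt htn
        _ = _ := by rw [Real.sqrt_mul (by norm_num), Real.sqrt_sq hn0.le]
    calc _ ≤ 3 * (2 * Real.exp (-(0.24 * n ^ 2 / t))) * (0.125 * (√0.08 * n / t ^ 2)) := by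
          refine mul_le_mul_of_nonneg_left (h2.trans ?_) (by positivity)
          gcongr
      _ = _ := by field_simp; ring

/-- The winding mass up to time `0.08 n²`: `0.005 / n` for the times up to order `n`, where it is
exponentially small in `n`, and `0.0445 / n` for the later ones. -/
theorem setIntegral_wrapping_le (hn : 20000000 ≤ n) :
    ∫ t in Ioc 0 (0.08 * (n : ℝ) ^ 2), (productHeatKernel (ZMod n) t (torusProj 3 n 0) -
      productHeatKernel ℤ t (0 : Fin 3 → ℤ)) ≤ 0.0495 / n := by
  have hn0 : (20000000 : ℝ) ≤ n := by exact_mod_cast hn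
  have hn1 : (0 : ℝ) < n := by linarith
  have hT : 0 < 0.08 * (n : ℝ) ^ 2 := by positivity
  have hb : 0 < 0.24 * (n : ℝ) ^ 2 := by positivity
  have hc : IntegrableOn (fun _ : ℝ => 6 * Real.exp (-(0.12 * n))) (Ioc 0 (0.08 * (n : ℝ) ^ 2)) :=
    integrable_const _
  have hI := (integrableOn_mul_exp_neg_div hb (0.08 * (n : ℝ) ^ 2)).const_mul
    (0.75 * (√0.08 * n / (0.24 * n ^ 2)))
  calc _ ≤ ∫ t in Ioc 0 (0.08 * (n : ℝ) ^ 2), (6 * Real.exp (-(0.12 * n)) +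
        0.75 * (√0.08 * n / (0.24 * n ^ 2)) *
          (0.24 * n ^ 2 / t ^ 2 * Real.exp (-(0.24 * n ^ 2 / t)))) := by
        refine setIntegral_mono_on ?_ (hc.add hI) measurableSet_Ioc fun t ht =>
          wrapping_pointwise_le (by omega) ht.1 ht.2
        exact ((continuous_productHeatKernel_zmod _).integrableOn_Ioc).sub
          ((integrableOn_productHeatKernel_int le_rfl _).mono_set Ioc_subset_Ioi_self)
    _ = 6 * Real.exp (-(0.12 * n)) * (0.08 * (n : ℝ) ^ 2) +
        0.75 * (√0.08 * n / (0.24 * n ^ 2)) * Real.exp (-3) := by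
        rw [integral_add hc hI, integral_const_mul (0.75 * (√0.08 * n / (0.24 * (n : ℝ) ^ 2))),
          setIntegral_mul_exp_neg_div hb hT, setIntegral_const, Real.volume_real_Ioc_of_le hT.le,
          sub_zero, smul_eq_mul, mul_comm (0.08 * (n : ℝ) ^ 2),
          show 0.24 * (n : ℝ) ^ 2 / (0.08 * n ^ 2) = 3 by field_simp; norm_num]
    _ ≤ 0.005 / n + 0.0445 / n := by
        refine add_le_add ?_ ?_
        · rw [le_div_iff₀ hn1]
          refine le_trans (le_of_eq ?_) (exp_neg_linear_le hn0)
          ring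
        · have h1 : √0.08 ≤ 0.2829 := by
            rw [Real.sqrt_le_left (by norm_num)]; norm_num
          calc 0.75 * (√0.08 * n / (0.24 * n ^ 2)) * Real.exp (-3)
              ≤ 0.75 * (0.2829 * n / (0.24 * (n : ℝ) ^ 2)) * 0.05 := by
                have := exp_neg_three_le
                gcongr
            _ = 0.75 * 0.2829 / 0.24 * 0.05 / (n : ℝ) := by field_simp
            _ ≤ _ := by gcongr; norm_num
    _ = _ := by ring

/-- The nonconstant modes after time `0.08 n²`. For `ε = torusOscillation n t ≤ 0.15` one has
`(1 + ε)³ - 1 ≤ 3.5 ε ≤ 10.5 exp (-38 t / n²)`. -/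
theorem setIntegral_oscillation_le (hn : 11 ≤ n) :
    ∫ t in Ioi (0.08 * (n : ℝ) ^ 2), (productHeatKernel (ZMod n) t (torusProj 3 n 0) -
      ((n : ℝ) ^ 3)⁻¹) ≤ 0.014 / n := by
  have hn1 : (0 : ℝ) < n := by exact_mod_cast (by omega : 0 < n)
  have hT : 0 < 0.08 * (n : ℝ) ^ 2 := by positivity
  have hneg : -(38 / (n : ℝ) ^ 2) < 0 := by
    have : 0 < 38 / (n : ℝ) ^ 2 := by positivity
    linarith
  calc _ ≤ ∫ t in Ioi (0.08 * (n : ℝ) ^ 2), ((n : ℝ) ^ 3)⁻¹ * 10.5 *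
        Real.exp (-(38 / (n : ℝ) ^ 2) * t) := by
        refine setIntegral_mono_on ((integrableOn_productHeatKernel_zmod_sub hn _).mono_set
          (Ioi_subset_Ioi hT.le)) ((integrableOn_exp_mul_Ioi hneg _).const_mul _) measurableSet_Ioi
          fun t ht => ?_
        have ht' : 0.08 * (n : ℝ) ^ 2 ≤ t := le_of_lt ht
        refine ((le_abs_self _).trans (abs_productHeatKernel_zmod_sub_le t _)).trans ?_
        rw [mul_assoc]
        refine mul_le_mul_of_nonneg_left ?_ (by positivity)
        have h1 := torusOscillation_le hn ht'
        have h2 := torusOscillation_le_const hn ht'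
        have h3 := torusOscillation_nonneg (n := n) t
        rw [neg_mul]
        set ε := torusOscillation n t
        have h4 : ε ^ 2 ≤ 0.15 * ε := by nlinarith
        have h5 : ε ^ 3 ≤ 0.0225 * ε := by nlinarith
        nlinarith
    _ = ((n : ℝ) ^ 3)⁻¹ * 10.5 *
        ((n : ℝ) ^ 2 / 38 * Real.exp (-(38 / (n : ℝ) ^ 2) * (0.08 * (n : ℝ) ^ 2))) := by
        rw [integral_const_mul, integral_exp_mul_Ioi hneg]
        congr 1
        field_simp
    _ ≤ ((n : ℝ) ^ 3)⁻¹ * 10.5 * ((n : ℝ) ^ 2 / 38 * 0.05) := by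
        have : Real.exp (-(38 / (n : ℝ) ^ 2) * (0.08 * (n : ℝ) ^ 2)) ≤ 0.05 := by
          refine (Real.exp_le_exp.mpr ?_).trans exp_neg_three_le
          rw [show -(38 / (n : ℝ) ^ 2) * (0.08 * (n : ℝ) ^ 2) = -3.04 by field_simp; norm_num]
          norm_num
        gcongr
    _ = 10.5 / 38 * 0.05 / n := by field_simp
    _ ≤ _ := by gcongr; norm_num

/-- Centring contributes `-0.08 / n` up to time `0.08 n²`, more than the wrap-around part and the
nonconstant modes can compensate; the heat kernel of `ℤ³` after that time only helps. -/
theorem torusGreen_sub_heatGreen_le (hn : 20000000 ≤ n) :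
    torusGreen 3 n (torusProj 3 n 0) - heatGreen 3 0 ≤ -(0.016 / n) := by
  have hn1 : (0 : ℝ) < n := by exact_mod_cast (by omega : 0 < n)
  have hT : 0 < 0.08 * (n : ℝ) ^ 2 := by positivity
  have hi1 := integrableOn_productHeatKernel_zmod_sub (by omega : 11 ≤ n) (torusProj 3 n 0)
  have hi2 := integrableOn_productHeatKernel_int (le_refl 3) 0
  have hsplit {f : ℝ → ℝ} (hf : IntegrableOn f (Ioi 0)) : ∫ t in Ioi (0 : ℝ), f t =
      (∫ t in Ioc 0 (0.08 * (n : ℝ) ^ 2), f t) + ∫ t in Ioi (0.08 * (n : ℝ) ^ 2), f t := by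
    rw [← Ioc_union_Ioi_eq_Ioi hT.le, setIntegral_union (Ioc_disjoint_Ioi le_rfl)
      measurableSet_Ioi (hf.mono_set Ioc_subset_Ioi_self) (hf.mono_set (Ioi_subset_Ioi hT.le))]
  have hc : Continuous fun t => productHeatKernel (ZMod n) t (torusProj 3 n 0) :=
    continuous_productHeatKernel_zmod _
  have h1 := setIntegral_wrapping_le hn
  have h2 := setIntegral_oscillation_le (by omega : 11 ≤ n)
  have h3 : 0 ≤ ∫ t in Ioi (0.08 * (n : ℝ) ^ 2), productHeatKernel ℤ t (0 : Fin 3 → ℤ) :=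
    setIntegral_nonneg measurableSet_Ioi fun t ht => productHeatKernel_nonneg ℤ (hT.trans ht).le _
  have h4 : ∫ t in Ioc 0 (0.08 * (n : ℝ) ^ 2),
      (productHeatKernel (ZMod n) t (torusProj 3 n 0) - ((n : ℝ) ^ 3)⁻¹) =
      (∫ t in Ioc 0 (0.08 * (n : ℝ) ^ 2), productHeatKernel (ZMod n) t (torusProj 3 n 0)) -
        0.08 / n := by
    rw [integral_sub hc.integrableOn_Ioc (integrable_const _), setIntegral_const,
      Real.volume_real_Ioc_of_le hT.le, sub_zero, smul_eq_mul]
    congr 1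
    field_simp
  rw [integral_sub hc.integrableOn_Ioc (hi2.mono_set Ioc_subset_Ioi_self)] at h1
  rw [torusGreen, heatGreen, hsplit hi1, hsplit hi2, h4]
  have e : -(0.016 / (n : ℝ)) = 0.0495 / n + 0.014 / n - 0.08 / n + 0.0005 / n := by ring
  have : 0 ≤ 0.0005 / (n : ℝ) := by positivity
  linarith

end signThree

theorem proposition2p7 (d : ℕ) (hd : 3 ≤ d) :
    -- the series defining the Green's function of `ℤ^d` converges
    (∀ x y : Fin d → ℤ, Summable fun k : ℕ => srwProb d k x y) ∧
    -- comparison on the whole fundamental box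
    (∃ C : ℝ, 0 < C ∧ ∃ N : ℕ, ∀ (n : ℕ) [NeZero n], N ≤ n →
      ∀ y ∈ fundamentalBox d n,
        |zeroAvgGreen d n 0 (torusProj d n y) - latticeGreen d 0 y|
          ≤ C * (n : ℝ) ^ (2 - (d : ℤ))) ∧
    -- decay at macroscopic distance
    (∀ a : ℝ, 0 < a → ∃ C : ℝ, 0 < C ∧ ∃ N : ℕ, ∀ (n : ℕ) [NeZero n], N ≤ n →
      ∀ y ∈ fundamentalBox d n, a * (n : ℝ) ≤ latticeNorm y →
        |zeroAvgGreen d n 0 (torusProj d n y)| ≤ C * (n : ℝ) ^ (2 - (d : ℤ))) ∧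
    -- order and sign of the difference on the diagonal for `d = 3`
    (d = 3 → ∃ c C : ℝ, 0 < c ∧ 0 < C ∧ ∃ N : ℕ, ∀ (n : ℕ) [NeZero n], N ≤ n →
      ∀ x : Fin d → ℤ,
        -(C * (n : ℝ) ^ (2 - (d : ℤ))) ≤
            zeroAvgGreen d n (torusProj d n x) (torusProj d n x) - latticeGreen d x x ∧
        zeroAvgGreen d n (torusProj d n x) (torusProj d n x) - latticeGreen d x x ≤
            -(c * (n : ℝ) ^ (2 - (d : ℤ)))) := by
  refine ⟨summable_srwProb hd, ?_, ?_, ?_⟩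
  · obtain ⟨C, hC, h⟩ := exists_abs_torusGreen_sub_heatGreen_le hd
    refine ⟨C, hC, 25, fun n _ hn y hy => ?_⟩
    rw [zeroAvgGreen_eq (by omega), latticeGreen_eq hd, zero_sub, zero_sub, torusGreen_neg,
      heatGreen_neg]
    exact h n hn y hy
  · intro a ha
    obtain ⟨C, hC, h⟩ := exists_abs_torusGreen_sub_heatGreen_le hd
    obtain ⟨C', hC', h'⟩ := exists_heatGreen_le hd
    have hd0 : (0 : ℝ) < d := by exact_mod_cast (by omega : 0 < d)
    refine ⟨C + C' * (a / d) ^ (2 - (d : ℤ)), by positivity, 25, fun n _ hn y hy hya => ?_⟩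
    have hn0 : (0 : ℝ) < n := by exact_mod_cast (by omega : 0 < n)
    rw [zeroAvgGreen_eq (by omega), zero_sub, torusGreen_neg, add_mul]
    have h1 := h n hn y hy
    obtain ⟨i, hi⟩ := exists_le_abs_of_le_latticeNorm hd (by positivity : 0 < a * n) hya
    have h2 := h' (a * n / d) (by positivity) y ⟨i, hi⟩
    rw [mul_div_right_comm, mul_zpow, ← mul_assoc] at h2
    have h3 := heatGreen_nonneg y
    rw [abs_le] at h1 ⊢
    have h4 : 0 ≤ C' * (a / d) ^ (2 - (d : ℤ)) * (n : ℝ) ^ (2 - (d : ℤ)) := by positivity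
    constructor <;> linarith
  · rintro rfl
    obtain ⟨C, hC, h⟩ := exists_abs_torusGreen_sub_heatGreen_le (le_refl 3)
    refine ⟨0.016, C, by norm_num, hC, 20000000, fun n _ hn x => ?_⟩
    have e : torusProj 3 n 0 = 0 := by funext i; simp [torusProj]
    rw [zeroAvgGreen_eq (by omega), latticeGreen_eq hd, sub_self, sub_self, ← e]
    refine ⟨(abs_le.mp (h n (by omega) 0 (mem_fundamentalBox_of_lt ?_))).1, ?_⟩
    · simp only [Pi.zero_apply, abs_zero, Finset.sum_const_zero, mul_zero]; omega
    · refine (torusGreen_sub_heatGreen_le hn).trans_eq ?_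
      norm_num [div_eq_mul_inv, zpow_neg_one]
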